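/- Let $\mathbb F_q$ be the finite field with $q$ elements, let $\vartheta:\mathbb F_q^+\to\mathbb C^\times$ be a nontrivial homomorphism, let $K\subseteq\mathbb Z_{\ge 1}$ be a finite set, and let $U_K(q)$ be the group of unipotent upper triangular matrices over $\mathbb F_q$ with rows and columns indexed by $K$. An arc on $K$ is a symbol $i\overset{a}{\frown}l$ with $i<l$ in $K$ and $a\in\mathbb F_q^\times$. For a multiset $\lambda$ of arcs let $m_{jk}(\lambda)$ be the number (with multiplicity) and $\mathrm{wt}_{jk}(\lambda)\in\mathbb F_q$ the sum of the labels of the arcs of $\lambda$ from $j$ to $k$. A $q$-set partition of $K$ is a multiset $\mu$ of arcs on $K$ in which no two distinct members share a left endpoint or share a right endpoint; the superclass of $U_K(q)$ indexed by $\mu$ is the set of all $1+x\bigl(\sum_{j\overset{b}{\frown}k\in\mu} b\,e_{jk}\bigr)y$ with $x,y\in U_K(q)$ (every element of $U_K(q)$ lies in exactly one superclass). The character $\chi^{i\overset{a}{\frown}l}$ of $U_K(q)$ takes on the superclass indexed by $\mu$ the value $0$ if there is $j\overset{b}{\frown}k\in\mu$ with $i=j<k<l$ or $i<j<k=l$,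 and otherwise the value $$\frac{q^{|\{j\in K\,:\,i<j<l\}|}}{q^{|\{j\overset{b}{\frown}k\in\mu\,:\,i<j<k<l\}|}}\,\vartheta\bigl(a\,\mathrm{wt}_{il}(\mu)\bigr).$$ For a finite multiset $\lambda$ of arcs on $K$ put $\chi^\lambda=\prod_{\alpha\in\lambda}\chi^\alpha$ (with multiplicity). Stack the endpoints of the arcs of $\lambda$ at each node as follows. Among arcs with the same left endpoint and different right endpoints, the left endpoint of the longer arc is above. Among arcs with the same right endpoint and different left endpoints, the right endpoint of the longer arc is above. The arcs from $j$ to $k$, listed in some order $a_1,\dots,a_m$, are stacked in this order from bottom to top at both endpoints, except that if $\mathrm{wt}_{jk}(\lambda)=0$ then the order of the two topmost ones is interchanged at the left endpoint. The label $\Lambda_K(\alpha)\in\{\circ,\bullet\}^2$ of a member $\alpha$ of $\lambda$ from $j$ to $k$ has first entry $\circ$ if $j\notin K$ or the left endpoint of $\alpha$ is below that of another arc of $\lambda$ starting at $j$, and $\bullet$ otherwise; its second entry is $\circ$ if $k\notin K$ or the right endpoint of $\alpha$ is below that of another arc of $\lambda$ ending at $k$, and $\bullet$ otherwise. Let $$\mathcal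 C_K(\lambda)=\{(i\overset{a}{\frown}k,\ j\overset{b}{\frown}l)\in\lambda\times\lambda : i<j<k<l,\ \Lambda_K(i\overset{a}{\frown}k)=(\circ,\bullet),\ \Lambda_K(j\overset{b}{\frown}l)=(\bullet,\circ)\}.$$ Corollary. Let $\lambda$ be a finite multiset of arcs on $K$ such that every member of $\lambda$ has label $(\circ,\bullet)$ or $(\bullet,\circ)$ under $\Lambda_K$, for some choice of the orders above. Then $$\langle\chi^\lambda,\mathbb 1\rangle=q^{|\mathcal C_K(\lambda)|},$$ where $\mathcal C_K(\lambda)$ is formed with the same orders, $\mathbb 1$ is the trivial character and $\langle f,g\rangle=\frac1{|U_K(q)|}\sum_{u\in U_K(q)}f(u)\overline{g(u)}$. -/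

import Mathlib

namespace UnipotentSupercharacter

/-- An arc `i ⌢ j` with `i < j` positive integers, labelled by a nonzero element of `F`. -/
@[ext]
structure Arc (F : Type*) [Zero F] where
  left : ℕ+
  right : ℕ+
  label : F
  left_lt_right : left < right
  label_ne_zero : label ≠ 0

noncomputable instance {F : Type*} [Zero F] : DecidableEq (Arc F) := Classical.decEq _

section Combinatorics

variable {F : Type*} [Field F]

/-- `lam` is a finite multiset of arcs on `K`: all the endpoints lie in `K`. -/
def IsArcMultiset (K : Finset ℕ+) (lam : Multiset (Arc F)) : Prop :=
  ∀ α ∈ lam, α.left ∈ K ∧ α.right ∈ K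

/-- A `q`-set partition of `K`: a multiset of arcs on `K` in which two distinct arcs never share
the left endpoint and never share the right endpoint. -/
def IsSetPartition (K : Finset ℕ+) (mu : Multiset (Arc F)) : Prop :=
  IsArcMultiset K mu ∧ (mu.map Arc.left).Nodup ∧ (mu.map Arc.right).Nodup

open Classical in
/-- The multiset of the arcs of `lam` from `j` to `k`. -/
noncomputable def arcsBetween (lam : Multiset (Arc F)) (j k : ℕ+) : Multiset (Arc F) :=
  lam.filter fun α => α.left = j ∧ α.right = k

/-- The multiplicity `m_{jk}(lam)`. -/
noncomputable def mult (lam : Multiset (Arc F)) (j k : ℕ+) : ℕ :=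
  Multiset.card (arcsBetween lam j k)

/-- The weight `wt_{jk}(lam)`: the sum in `F` of the labels of the arcs from `j` to `k`. -/
noncomputable def wt (lam : Multiset (Arc F)) (j k : ℕ+) : F :=
  ((arcsBetween lam j k).map Arc.label).sum

end Combinatorics

section Group

/-- A matrix that is upper triangular with ones on the diagonal. -/
def IsUnitriangular {ι F : Type*} [LinearOrder ι] [Field F] (M : Matrix ι ι F) : Prop :=
  (∀ i, M i i = 1) ∧ ∀ i j, j < i → M i j = 0

theorem IsUnitriangular.mul_apply_self {ι F : Type*} [LinearOrder ι] [Fintype ι] [Field F]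
    {M N : Matrix ι ι F} (hM : ∀ i j, j < i → M i j = 0) (hN : ∀ i j, j < i → N i j = 0) (i : ι) :
    (M * N) i i = M i i * N i i := by
  rw [Matrix.mul_apply]
  refine Finset.sum_eq_single i (fun j _ hj => ?_) (by simp)
  rcases lt_or_gt_of_ne hj with h | h
  · rw [hM i j h, zero_mul]
  · rw [hN j i h, mul_zero]

/-- The group `U_K` over `F` of the unipotent upper triangular matrices with rows and columns
indexed by the finite set `K`. -/
noncomputable def U (K : Finset ℕ+) (F : Type*) [Field F] : Subgroup (Matrix K K F)ˣ where
  carrier := {u | IsUnitriangular (u : Matrix K K F)}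
  one_mem' := ⟨fun i => by simp, fun i j h => by simp [Matrix.one_apply_ne h.ne']⟩
  mul_mem' := by
    rintro u v ⟨hu, hu'⟩ ⟨hv, hv'⟩
    refine ⟨fun i => ?_, fun i j h => ?_⟩
    · rw [Units.val_mul, IsUnitriangular.mul_apply_self hu' hv', hu, hv, one_mul]
    · have h1 : Matrix.BlockTriangular (u : Matrix K K F) id := fun a b hab => hu' a b hab
      have h2 : Matrix.BlockTriangular (v : Matrix K K F) id := fun a b hab => hv' a b hab
      exact h1.mul h2 h
  inv_mem' := by
    rintro u ⟨hu, hu'⟩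
    have h1 : Matrix.BlockTriangular (u : Matrix K K F) id := fun a b hab => hu' a b hab
    have : Invertible (u : Matrix K K F) := u.invertible
    have h2 := Matrix.blockTriangular_inv_of_blockTriangular h1
    rw [← Matrix.coe_units_inv] at h2
    refine ⟨fun i => ?_, fun i j h => h2 h⟩
    have h3 := IsUnitriangular.mul_apply_self hu' (fun a b hab => h2 hab) i
    rw [hu, one_mul, Units.mul_inv, Matrix.one_apply_eq] at h3
    exact h3.symm

noncomputable instance (K : Finset ℕ+) (F : Type*) [Field F] [Fintype F] : Fintype (U K F) :=
  Fintype.ofFinite _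

/-- The usual inner product of complex-valued functions on a finite group. -/
noncomputable def charInner {G : Type*} [Group G] [Fintype G] (f g : G → ℂ) : ℂ :=
  (Fintype.card G : ℂ)⁻¹ * ∑ u : G, f u * star (g u)

end Group

section Supercharacters

variable {F : Type*} [Field F]

/-- The strictly upper triangular matrix `∑ b e_{jk}`, summed over the arcs of `mu` on `K`. -/
noncomputable def arcMatrix (K : Finset ℕ+) (mu : Multiset (Arc F)) : Matrix K K F :=
  Matrix.of fun j k => wt mu j k

/-- The `q`-set partition `mu` of `K` indexes the superclass of `u`, which is the set of all
`1 + x (u - 1) y` with `x`, `y` in `U_K`. -/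
def IndexesSuperclass (K : Finset ℕ+) (mu : Multiset (Arc F)) (u : U K F) : Prop :=
  IsSetPartition K mu ∧ ∃ x y : U K F,
    ((u : (Matrix K K F)ˣ) : Matrix K K F) =
      1 + ((x : (Matrix K K F)ˣ) : Matrix K K F) * arcMatrix K mu *
        ((y : (Matrix K K F)ˣ) : Matrix K K F)

/-- The `q`-set partition that indexes the superclass of `u`. Row and column reduction shows that
each `u` has exactly one. -/
noncomputable def superclassIndex (K : Finset ℕ+) (u : U K F) : Multiset (Arc F) :=
  Classical.epsilon fun mu => IndexesSuperclass K mu u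

variable [Fintype F]

open Classical in
/-- The value on the superclass indexed by `mu` of the irreducible character of a single arc. -/
noncomputable def arcValue (θ : AddChar F ℂ) (K : Finset ℕ+) (α : Arc F)
    (mu : Multiset (Arc F)) : ℂ :=
  if ∃ β ∈ mu, (α.left = β.left ∧ β.right < α.right) ∨ (α.left < β.left ∧ β.right = α.right) then 0
  else
    (Fintype.card F : ℂ) ^ (K.filter fun j => α.left < j ∧ j < α.right).card /
      (Fintype.card F : ℂ) ^
        Multiset.card (mu.filter fun β => α.left < β.left ∧ β.right < α.right) *
      θ (α.label * wt mu α.left α.right)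

/-- The character of `U_K` attached to a single arc. -/
noncomputable def arcChar (θ : AddChar F ℂ) (K : Finset ℕ+) (α : Arc F) : U K F → ℂ :=
  fun u => arcValue θ K α (superclassIndex K u)

/-- The character `χ^lam` of `U_K`: the product (that is, the tensor product) of the characters of
the arcs of `lam`, taken with multiplicity. -/
noncomputable def chi (θ : AddChar F ℂ) (K : Finset ℕ+) (lam : Multiset (Arc F)) : U K F → ℂ :=
  fun u => (lam.map fun α => arcChar θ K α u).prod

end Supercharacters

section Labelling

variable {F : Type*} [Field F] {lam : Multiset (Arc F)}

/-- The position, counted from `0`, of an occurrence of an arc `j ⌢ k` of `lam` in the list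
`a_1, …, a_m` of all the occurrences of arcs from `j` to `k` in `lam`. The order of these lists is
the one given by the enumeration `pos` of the occurrences. -/
noncomputable def stackIndex (pos : lam.ToType ↪ ℕ) (α : lam.ToType) : ℕ :=
  Set.ncard {β : lam.ToType |
    β.1.left = α.1.left ∧ β.1.right = α.1.right ∧ pos β < pos α}

/-- The height of the right endpoint within the stack of the arcs from `j` to `k`. -/
noncomputable def rightHeight (pos : lam.ToType ↪ ℕ) (α : lam.ToType) : ℕ :=
  stackIndex pos α

open Classical in
/-- The height of the left endpoint within the stack of the arcs from `j` to `k`. It is the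
height of the right endpoint, except that the two topmost arcs are crossed if the weight is zero
(there are then at least two arcs). -/
noncomputable def leftHeight (pos : lam.ToType ↪ ℕ) (α : lam.ToType) : ℕ :=
  if wt lam α.1.left α.1.right = 0 then
    Equiv.swap (mult lam α.1.left α.1.right - 2) (mult lam α.1.left α.1.right - 1)
      (stackIndex pos α)
  else stackIndex pos α

/-- The occurrence `α` starts below the occurrence `β`, at the same node. -/
def StartsBelow (pos : lam.ToType ↪ ℕ) (α β : lam.ToType) : Prop :=
  α.1.left = β.1.left ∧ (α.1.right < β.1.right ∨
    (α.1.right = β.1.right ∧ leftHeight pos α < leftHeight pos β))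

/-- The occurrence `α` ends below the occurrence `β`, at the same node. -/
def EndsBelow (pos : lam.ToType ↪ ℕ) (α β : lam.ToType) : Prop :=
  α.1.right = β.1.right ∧ (β.1.left < α.1.left ∨
    (α.1.left = β.1.left ∧ rightHeight pos α < rightHeight pos β))

/-- The two marks `∘` and `•`. -/
inductive Mark
  | hollow
  | solid

open Classical in
/-- The labelling function `Λ_K` on the occurrences of arcs in `lam`. -/
noncomputable def Lam (K : Finset ℕ+) (pos : lam.ToType ↪ ℕ) (α : lam.ToType) : Mark × Mark :=
  (if α.1.left ∉ K ∨ ∃ β, StartsBelow pos α β then Mark.hollow else Mark.solid,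
   if α.1.right ∉ K ∨ ∃ β, EndsBelow pos α β then Mark.hollow else Mark.solid)

/-- The set `C_K(lam)` of the crossings of a `(∘,•)` arc `i ⌢ k` with a `(•,∘)` arc `j ⌢ l`, where
`i < j < k < l`. -/
def crossings (K : Finset ℕ+) (pos : lam.ToType ↪ ℕ) : Set (lam.ToType × lam.ToType) :=
  {p | p.1.1.left < p.2.1.left ∧ p.2.1.left < p.1.1.right ∧ p.1.1.right < p.2.1.right ∧
    Lam K pos p.1 = (Mark.hollow, Mark.solid) ∧ Lam K pos p.2 = (Mark.solid, Mark.hollow)}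

end Labelling

end UnipotentSupercharacter

open UnipotentSupercharacter

/-! Up to a normalizing factor, the character of an arc from `i` to `l` with label `a` is the sum of
`θ (a * x N y)` with `N = u - 1`, where `x` runs over row vectors with entry 1 at `i` and zeros
before it, and `y` over column vectors with entry 1 at `l` and zeros after it (`arcChar_eq`). This
sum is invariant under `N ↦ g N h`, so it only has to be evaluated on the matrices of set
partitions.

A product over arcs becomes a sum of `θ (tr (D X N Yᵀ))`, where `D` is the diagonal matrix of the
labels and `X`, `Y` collect the vectors. The labelling hypothesis makes the family alternating: each
arc has one solid and one hollow end, and a hollow end lies below exactly one solid end. Adding the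
vectors of other arcs changes the leading entries at all hollow ends from 1 to 0, and a dual pair of
shears does so on both sides without changing the trace (`IsAlternating.prod_pairSum_eq`). The
interchange of the two topmost arcs at weight zero is what makes the two sides compatible for
parallel arcs.

With leading entry 0, summing over a hollow end gives just the indicator of linear conditions on
`N`. The vectors at the solid ends fit into the rows of one unitriangular `g` and the columns of
another, `h`, and in terms of `g N h` the conditions say that certain entries vanish
(`IsAlternating.card_endCondition`). An arc forces as many entries as the exponent of its degree,
and an entry is forced twice exactly at a crossing. Inclusion–exclusion
(`IsAlternating.card_not_forced`) therefore leaves one factor `q` per crossing. -/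

namespace UnipotentSupercharacter

/-! ### Character sums over affine coordinate subspaces. -/

section Vectors

open Finset Matrix
open scoped Classical

variable {σ F : Type*} [Fintype σ] [Field F] [Fintype F]

/-- The vectors that agree with `c` at the coordinates where `p` holds. -/
noncomputable def agreeOn (p : σ → Prop) (c : σ → F) : Finset (σ → F) :=
  univ.filter fun x => ∀ s, p s → x s = c s

omit [Field F] in
theorem mem_agreeOn {p : σ → Prop} {c x : σ → F} :
    x ∈ agreeOn p c ↔ ∀ s, p s → x s = c s := by
  simp [agreeOn]

omit [Field F] in
theorem card_agreeOn (p : σ → Prop) (c : σ → F) :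
    #(agreeOn p c) = Fintype.card F ^ #{s | ¬ p s} := by
  have h : agreeOn p c = Fintype.piFinset fun s => if p s then {c s} else (univ : Finset F) := by
    ext x
    rw [mem_agreeOn, Fintype.mem_piFinset]
    refine forall_congr' fun s => ?_
    by_cases hs : p s <;> simp [hs]
  rw [h, Fintype.card_piFinset]
  have h2 : ∀ s, #(if p s then {c s} else (univ : Finset F)) =
      if ¬ p s then Fintype.card F else 1 := by
    intro s
    by_cases hs : p s <;> simp [hs]
  simp_rw [h2]
  rw [Finset.prod_ite]
  simp

theorem card_agreeOn_ne_zero (p : σ → Prop) (c : σ → F) : (#(agreeOn p c) : ℂ) ≠ 0 := by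
  rw [card_agreeOn]
  exact_mod_cast pow_ne_zero _ Fintype.card_ne_zero

omit [Fintype F] in
theorem exists_addChar_ne_one {θ : AddChar F ℂ} (hθ : θ ≠ 1) {v : F} (hv : v ≠ 0) :
    ∃ t, θ (t * v) ≠ 1 := by
  obtain ⟨s, hs⟩ := AddChar.ne_one_iff.1 hθ
  exact ⟨s / v, by rwa [div_mul_cancel₀ _ hv]⟩

/-- Orthogonality of characters for the sum over an affine coordinate subspace. -/
theorem sum_agreeOn {θ : AddChar F ℂ} (hθ : θ ≠ 1) (p : σ → Prop) (c v : σ → F) :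
    ∑ x ∈ agreeOn p c, θ (x ⬝ᵥ v) =
      if ∀ s, ¬ p s → v s = 0 then (#(agreeOn p c) : ℂ) * θ (c ⬝ᵥ v) else 0 := by
  split_ifs with h
  · rw [Finset.sum_congr rfl (g := fun _ => θ (c ⬝ᵥ v)), Finset.sum_const, nsmul_eq_mul]
    intro x hx
    congr 1
    refine Finset.sum_congr rfl fun s _ => ?_
    by_cases hs : p s
    · rw [mem_agreeOn.1 hx s hs]
    · rw [h s hs, mul_zero, mul_zero]
  · push Not at h
    obtain ⟨s, hs, hv⟩ := h
    obtain ⟨t, ht⟩ := exists_addChar_ne_one hθ hv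
    -- Translation by `t` in the free coordinate `s` permutes the summands and multiplies the sum by
    -- `θ (t * v s) ≠ 1`, so the sum is zero.
    have key : ∑ x ∈ agreeOn p c, θ (x ⬝ᵥ v) =
        ∑ x ∈ agreeOn p c, θ (t * v s) * θ (x ⬝ᵥ v) := by
      refine Finset.sum_nbij' (fun x => x - Pi.single s t) (fun x => x + Pi.single s t)
        ?_ ?_ ?_ ?_ ?_
      · intro x hx
        refine mem_agreeOn.2 fun r hr => ?_
        have : r ≠ s := fun h => hs (h ▸ hr)
        simp [this, mem_agreeOn.1 hx r hr]
      · intro x hx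
        refine mem_agreeOn.2 fun r hr => ?_
        have : r ≠ s := fun h => hs (h ▸ hr)
        simp [this, mem_agreeOn.1 hx r hr]
      · intro x _; simp
      · intro x _; simp
      · intro x _
        rw [← AddChar.map_add_eq_mul, sub_dotProduct, single_dotProduct]
        congr 1
        ring
    rw [← Finset.mul_sum] at key
    have h3 : (1 - θ (t * v s)) * ∑ x ∈ agreeOn p c, θ (x ⬝ᵥ v) = 0 := by
      rw [sub_mul, one_mul, ← key, sub_self]
    exact (mul_eq_zero.1 h3).resolve_left (sub_ne_zero.2 (Ne.symm ht))

omit [Fintype F] in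
theorem mulShift_ne_one_of_ne_zero {θ : AddChar F ℂ} (hθ : θ ≠ 1) {a : F} (ha : a ≠ 0) :
    AddChar.mulShift θ a ≠ 1 := by
  obtain ⟨t, ht⟩ := exists_addChar_ne_one hθ ha
  refine AddChar.ne_one_iff.2 ⟨t, ?_⟩
  rwa [AddChar.mulShift_apply, mul_comm]

end Vectors

/-! ### Unitriangular matrices and sums over pairs of vectors. -/

section Triangular

open Finset Matrix
open scoped Classical

variable {K : Finset ℕ+} {F : Type*} [Field F]

/-- The row vectors supported to the right of `i`, with the entry `c` at `i`. -/
noncomputable def rowVecs [Fintype F] (i : K) (c : F) : Finset (K → F) :=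
  agreeOn (fun j => j ≤ i) (Pi.single i c)

/-- The column vectors supported above `l`, with the entry `c` at `l`. -/
noncomputable def colVecs [Fintype F] (l : K) (c : F) : Finset (K → F) :=
  agreeOn (fun k => l ≤ k) (Pi.single l c)

theorem mem_rowVecs [Fintype F] {i : K} {c : F} {x : K → F} :
    x ∈ rowVecs i c ↔ x i = c ∧ ∀ j, j < i → x j = 0 := by
  rw [rowVecs, mem_agreeOn]
  constructor
  · intro h
    refine ⟨by simpa using h i le_rfl, fun j hj => ?_⟩
    simpa [hj.ne] using h j hj.le
  · rintro ⟨h1, h2⟩ j hj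
    rcases hj.eq_or_lt with rfl | hj
    · simpa using h1
    · simpa [hj.ne] using h2 j hj

theorem mem_colVecs [Fintype F] {l : K} {c : F} {x : K → F} :
    x ∈ colVecs l c ↔ x l = c ∧ ∀ k, l < k → x k = 0 := by
  rw [colVecs, mem_agreeOn]
  constructor
  · intro h
    refine ⟨by simpa using h l le_rfl, fun j hj => ?_⟩
    simpa [hj.ne'] using h j hj.le
  · rintro ⟨h1, h2⟩ j hj
    rcases hj.eq_or_lt with rfl | hj
    · simpa using h1
    · simpa [hj.ne'] using h2 j hj

theorem exists_mem_U {M : Matrix K K F} (hM : IsUnitriangular M) : ∃ u : U K F, u.1.1 = M := by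
  have hdet : M.det = 1 := by
    rw [Matrix.det_of_isUpperTriangular (fun a b hab => hM.2 a b hab)]
    simp [hM.1]
  have hu : IsUnit M := by
    rw [Matrix.isUnit_iff_isUnit_det, hdet]
    exact isUnit_one
  exact ⟨⟨hu.unit, hM⟩, rfl⟩

theorem mulVec_apply_eq_zero (g : U K F) {i : K} {v : K → F} (hv : ∀ j, i < j → v j = 0)
    {j : K} (hj : i < j) : (g.1.1 *ᵥ v) j = 0 := by
  refine Finset.sum_eq_zero fun k _ => ?_
  rcases lt_or_ge k j with h | h
  · dsimp only
    rw [g.2.2 _ _ h, zero_mul]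
  · rw [hv k (hj.trans_le h), mul_zero]

theorem vecMul_apply_eq_zero (g : U K F) {l : K} {v : K → F} (hv : ∀ k, k < l → v k = 0)
    {k : K} (hk : k < l) : (v ᵥ* g.1.1) k = 0 := by
  refine Finset.sum_eq_zero fun j _ => ?_
  rcases lt_or_ge k j with h | h
  · dsimp only
    rw [g.2.2 _ _ h, mul_zero]
  · rw [hv j (h.trans_lt hk), zero_mul]

theorem mulVec_inv_mulVec (g : U K F) (v : K → F) : (g⁻¹).1.1 *ᵥ (g.1.1 *ᵥ v) = v := by
  rw [Matrix.mulVec_mulVec, ← Units.val_mul, ← Subgroup.coe_mul, inv_mul_cancel]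
  simp

theorem vecMul_vecMul_inv (g : U K F) (v : K → F) : (v ᵥ* g.1.1) ᵥ* (g⁻¹).1.1 = v := by
  rw [Matrix.vecMul_vecMul, ← Units.val_mul, ← Subgroup.coe_mul, mul_inv_cancel]
  simp

/-- Both `g` and its inverse are upper triangular, so both preserve the vectors supported on the
coordinates up to `i`. This allows conditions on `N z` to be read off from `g N z`. -/
theorem mulVec_forall_eq_zero_iff (g : U K F) (i : K) (v : K → F) :
    (∀ j, i < j → (g.1.1 *ᵥ v) j = 0) ↔ ∀ j, i < j → v j = 0 := by
  refine ⟨fun h j hj => ?_, fun h j hj => mulVec_apply_eq_zero g h hj⟩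
  rw [← mulVec_inv_mulVec g v]
  exact mulVec_apply_eq_zero g⁻¹ h hj

theorem vecMul_forall_eq_zero_iff (g : U K F) (l : K) (v : K → F) :
    (∀ k, k < l → (v ᵥ* g.1.1) k = 0) ↔ ∀ k, k < l → v k = 0 := by
  refine ⟨fun h j hj => ?_, fun h j hj => vecMul_apply_eq_zero g h hj⟩
  rw [← vecMul_vecMul_inv g v]
  exact vecMul_apply_eq_zero g⁻¹ h hj

theorem vecMul_mem_rowVecs [Fintype F] (g : U K F) {i : K} {c : F} {x : K → F}
    (hx : x ∈ rowVecs i c) : x ᵥ* g.1.1 ∈ rowVecs i c := by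
  rw [mem_rowVecs] at hx ⊢
  refine ⟨?_, fun j hj => vecMul_apply_eq_zero g hx.2 hj⟩
  rw [← hx.1]
  refine (Finset.sum_eq_single i (fun j _ hj => ?_) (by simp)).trans (by dsimp only; rw [g.2.1, mul_one])
  rcases lt_or_gt_of_ne hj with h | h
  · rw [hx.2 j h, zero_mul]
  · dsimp only
    rw [g.2.2 _ _ h, mul_zero]

theorem mulVec_mem_colVecs [Fintype F] (g : U K F) {l : K} {c : F} {x : K → F}
    (hx : x ∈ colVecs l c) : g.1.1 *ᵥ x ∈ colVecs l c := by
  rw [mem_colVecs] at hx ⊢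
  refine ⟨?_, fun j hj => mulVec_apply_eq_zero g hx.2 hj⟩
  rw [← hx.1]
  refine (Finset.sum_eq_single l (fun j _ hj => ?_) (by simp)).trans (by dsimp only; rw [g.2.1, one_mul])
  rcases lt_or_gt_of_ne hj with h | h
  · dsimp only
    rw [g.2.2 _ _ h, zero_mul]
  · rw [hx.2 j h, mul_zero]

/-- The matrix is strictly upper triangular. -/
def IsStrictUpper (N : Matrix K K F) : Prop := ∀ j k, k ≤ j → N j k = 0

theorem IsStrictUpper.mul_left {N : Matrix K K F} (hN : IsStrictUpper N) (g : U K F) :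
    IsStrictUpper (g.1.1 * N) := by
  intro j k hjk
  rw [Matrix.mul_apply]
  refine Finset.sum_eq_zero fun m _ => ?_
  rcases lt_or_ge m j with h | h
  · rw [g.2.2 _ _ h, zero_mul]
  · rw [hN m k (hjk.trans h), mul_zero]

theorem IsStrictUpper.mul_right {N : Matrix K K F} (hN : IsStrictUpper N) (g : U K F) :
    IsStrictUpper (N * g.1.1) := by
  intro j k hjk
  rw [Matrix.mul_apply]
  refine Finset.sum_eq_zero fun m _ => ?_
  rcases lt_or_ge k m with h | h
  · rw [g.2.2 _ _ h, mul_zero]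
  · rw [hN j m (h.trans hjk), zero_mul]

theorem isStrictUpper_sub_one (u : U K F) : IsStrictUpper (u.1.1 - 1) := by
  intro j k hjk
  rcases hjk.eq_or_lt with rfl | h
  · simp [u.2.1 k]
  · simp [u.2.2 _ _ h, Matrix.one_apply_ne h.ne']

theorem IsStrictUpper.exists_U {N : Matrix K K F} (hN : IsStrictUpper N) :
    ∃ u : U K F, u.1.1 = 1 + N := by
  refine exists_mem_U ⟨fun i => by simp [hN i i le_rfl], fun i j h => ?_⟩
  simp [hN i j h.le, Matrix.one_apply_ne h.ne']

/-- The finite set of the strictly upper triangular matrices. -/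
noncomputable def strictUpper (K : Finset ℕ+) (F : Type*) [Field F] [Fintype F] :
    Finset (Matrix K K F) :=
  univ.filter IsStrictUpper

theorem mem_strictUpper [Fintype F] {N : Matrix K K F} :
    N ∈ strictUpper K F ↔ IsStrictUpper N := by
  simp [strictUpper]

theorem sum_U [Fintype F] (f : Matrix K K F → ℂ) :
    ∑ u : U K F, f (u.1.1 - 1) = ∑ N ∈ strictUpper K F, f N := by
  refine Finset.sum_bij (fun u _ => u.1.1 - 1) (fun u _ => ?_) (fun u _ v _ h => ?_)
    (fun N hN => ?_) (fun u _ => rfl)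
  · exact mem_strictUpper.2 (isStrictUpper_sub_one u)
  · exact Subtype.ext (Units.ext (sub_left_injective h))
  · obtain ⟨u, hu⟩ := (mem_strictUpper.1 hN).exists_U
    exact ⟨u, mem_univ _, by rw [hu]; simp⟩

/-- The finite set of the matrices with zeros at the positions where `p` holds. -/
noncomputable def zeroOn (F : Type*) [Field F] [Fintype F] (p : K → K → Prop) :
    Finset (Matrix K K F) :=
  univ.filter fun N => ∀ j k, p j k → N j k = 0

theorem mem_zeroOn [Fintype F] {p : K → K → Prop} {N : Matrix K K F} :
    N ∈ zeroOn F p ↔ ∀ j k, p j k → N j k = 0 := by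
  simp [zeroOn]

theorem card_zeroOn [Fintype F] (p : K → K → Prop) :
    #(zeroOn F p) = Fintype.card F ^ #{s : K × K | ¬ p s.1 s.2} := by
  rw [← card_agreeOn (fun s : K × K => p s.1 s.2) (fun _ => (0 : F))]
  refine Finset.card_nbij' (fun N s => N s.1 s.2) (fun f => Matrix.of fun j k => f (j, k))
    ?_ ?_ ?_ ?_
  · exact fun N hN => mem_coe.2 (mem_agreeOn.2 fun s hs => mem_zeroOn.1 (mem_coe.1 hN) _ _ hs)
  · exact fun f hf => mem_coe.2 (mem_zeroOn.2 fun j k h => mem_agreeOn.1 (mem_coe.1 hf) (j, k) h)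
  · intro N _; rfl
  · intro f _; rfl

theorem card_U [Fintype F] :
    Fintype.card (U K F) = Fintype.card F ^ #{s : K × K | s.1 < s.2} := by
  have h := sum_U (K := K) (F := F) fun _ => 1
  simp only [sum_const, nsmul_eq_mul, mul_one, card_univ, Nat.cast_inj] at h
  rw [h]
  have h2 := card_zeroOn (K := K) (F := F) fun j k => k ≤ j
  simp only [not_le] at h2
  rw [← h2]
  congr 1
  ext N
  rw [mem_strictUpper, mem_zeroOn, IsStrictUpper]

/-- The sum over all pairs of a row vector and a column vector that defines the character of a
single arc, up to normalization. -/
noncomputable def pairSum [Fintype F] (θ : AddChar F ℂ) (a : F) (i l : K) (c d : F)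
    (N : Matrix K K F) : ℂ :=
  ∑ x ∈ rowVecs i c, ∑ y ∈ colVecs l d, θ (a * (x ⬝ᵥ (N *ᵥ y)))

/-- The substitutions `x ↦ x g` and `y ↦ h y` permute the two ranges of summation, since
unitriangular matrices preserve supports and leading entries. Hence the sum is constant on
superclasses. -/
theorem pairSum_mul_mul [Fintype F] (θ : AddChar F ℂ) (a : F) (i l : K) (c d : F)
    (N : Matrix K K F) (g h : U K F) :
    pairSum θ a i l c d (g.1.1 * N * h.1.1) = pairSum θ a i l c d N := by
  refine Finset.sum_nbij' (fun x => x ᵥ* g.1.1) (fun x => x ᵥ* (g⁻¹).1.1)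
    (fun x hx => vecMul_mem_rowVecs g hx) (fun x hx => vecMul_mem_rowVecs g⁻¹ hx)
    (fun x _ => vecMul_vecMul_inv g x)
    (fun x _ => by simp) (fun x _ => ?_)
  refine Finset.sum_nbij' (fun y => h.1.1 *ᵥ y) (fun y => (h⁻¹).1.1 *ᵥ y)
    (fun x hx => mulVec_mem_colVecs h hx) (fun x hx => mulVec_mem_colVecs h⁻¹ hx)
    (fun x _ => mulVec_inv_mulVec h x)
    (fun x _ => by simp) (fun y _ => ?_)
  simp only [Matrix.dotProduct_mulVec, Matrix.vecMul_vecMul, Matrix.mul_assoc]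

/-- The entries of `x` after `i` are free, so orthogonality kills every `y` for which `N y` is
nonzero after `i`. Only the fixed entry `c` leaves a character value, which is trivial for `c = 0`.
-/
theorem pairSum_eq_sum_col [Fintype F] {θ : AddChar F ℂ} (hθ : θ ≠ 1) {a : F} (ha : a ≠ 0)
    (i l : K) (c d : F) (N : Matrix K K F) :
    pairSum θ a i l c d N = #(rowVecs i c) * ∑ y ∈ colVecs l d,
      if ∀ j, i < j → (N *ᵥ y) j = 0 then θ (a * (c * (N *ᵥ y) i)) else 0 := by
  rw [pairSum, Finset.sum_comm, Finset.mul_sum]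
  refine Finset.sum_congr rfl fun y _ => ?_
  have h := sum_agreeOn (mulShift_ne_one_of_ne_zero hθ ha) (fun j => j ≤ i) (Pi.single i c) (N *ᵥ y)
  simp only [AddChar.mulShift_apply, not_le, single_dotProduct] at h
  rw [rowVecs, h, mul_ite, mul_zero]

theorem pairSum_eq_sum_row [Fintype F] {θ : AddChar F ℂ} (hθ : θ ≠ 1) {a : F} (ha : a ≠ 0)
    (i l : K) (c d : F) (N : Matrix K K F) :
    pairSum θ a i l c d N = #(colVecs l d) * ∑ x ∈ rowVecs i c,
      if ∀ k, k < l → (x ᵥ* N) k = 0 then θ (a * (d * (x ᵥ* N) l)) else 0 := by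
  rw [pairSum, Finset.mul_sum]
  refine Finset.sum_congr rfl fun x _ => ?_
  have h := sum_agreeOn (mulShift_ne_one_of_ne_zero hθ ha) (fun j => l ≤ j) (Pi.single l d) (x ᵥ* N)
  simp only [AddChar.mulShift_apply, not_le, single_dotProduct] at h
  rw [colVecs, mul_ite, mul_zero, ← h]
  refine Finset.sum_congr rfl fun y _ => ?_
  rw [Matrix.dotProduct_mulVec, dotProduct_comm]

end Triangular

/-! ### Every superclass contains the matrix of a set partition. -/

section Reduction

open Finset Matrix
open scoped Classical

variable {K : Finset ℕ+} {F : Type*} [Field F]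

theorem exists_U_eq_transvection {j k : K} (hjk : j < k) (c : F) :
    ∃ u : U K F, u.1.1 = Matrix.transvection j k c := by
  refine exists_mem_U ⟨fun i => ?_, fun i m h => ?_⟩
  · rw [Matrix.transvection, Matrix.add_apply, Matrix.one_apply_eq, Matrix.single_apply,
      if_neg fun h => hjk.ne (h.1.trans h.2.symm), add_zero]
  · rw [Matrix.transvection, Matrix.add_apply, Matrix.one_apply_ne h.ne', Matrix.single_apply,
      if_neg fun h' => ?_, add_zero]
    obtain ⟨rfl, rfl⟩ := h'
    exact lt_asymm h hjk

/-- The zero pattern of a matrix, read row by row from the bottom row to the top row, with the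
lexicographic order. -/
noncomputable def zeroPattern (M : Matrix K K F) : Lex ((Kᵒᵈ ×ₗ K) → ℕ) :=
  toLex fun p => if M (OrderDual.ofDual (ofLex p).1) (ofLex p).2 = 0 then 0 else 1

/-- In the reading order only the rows below `j` and the entries of row `j` left of `k` precede `(j,
k)`; all later entries may change arbitrarily. -/
theorem zeroPattern_lt {M M' : Matrix K K F} {j k : K} (h : M j k ≠ 0) (h' : M' j k = 0)
    (h1 : ∀ j' k', j < j' → (M' j' k' = 0 ↔ M j' k' = 0))
    (h2 : ∀ k', k' < k → (M' j k' = 0 ↔ M j k' = 0)) : zeroPattern M' < zeroPattern M := by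
  refine ⟨toLex (OrderDual.toDual j, k), fun p hp => ?_, ?_⟩
  · have key : M' (OrderDual.ofDual (ofLex p).1) (ofLex p).2 = 0 ↔
        M (OrderDual.ofDual (ofLex p).1) (ofLex p).2 = 0 := by
      rcases Prod.Lex.lt_iff.1 hp with h3 | ⟨h3, h4⟩
      · exact h1 _ _ h3
      · have h5 : OrderDual.ofDual (ofLex p).1 = j := h3
        rw [h5]
        exact h2 _ h4
    exact if_congr key rfl rfl
  · change (if M' j k = 0 then 0 else 1) < (if M j k = 0 then 0 else 1)
    simp [h, h']

/-- The nonzero entry at `(j, k)` has a nonzero entry to its left or below it. -/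
def HasConflict (M : Matrix K K F) (j k : K) : Prop :=
  M j k ≠ 0 ∧ ((∃ k' < k, M j k' ≠ 0) ∨ ∃ j', j < j' ∧ M j' k ≠ 0)

/-- A conflict that is first in the reading order can be cleared by one transvection: the absence of
earlier conflicts guarantees that no earlier entry is disturbed. -/
theorem exists_zeroPattern_lt {M : Matrix K K F} {j k : K} (hM : HasConflict M j k) :
    ∃ g h : U K F, zeroPattern (g.1.1 * M * h.1.1) < zeroPattern M := by
  obtain ⟨p, hp, hmin⟩ := WellFounded.has_min (wellFounded_lt (α := Kᵒᵈ ×ₗ K))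
    {p | HasConflict M (OrderDual.ofDual (ofLex p).1) (ofLex p).2}
    ⟨toLex (OrderDual.toDual j, k), hM⟩
  clear hM
  obtain ⟨j, k, rfl⟩ : ∃ j k, p = toLex (OrderDual.toDual j, k) := ⟨_, _, rfl⟩
  replace hp : HasConflict M j k := hp
  have hrow : ∀ k' < k, ¬ HasConflict M j k' := fun k' hk' hc =>
    hmin (toLex (OrderDual.toDual j, k')) hc (Prod.Lex.lt_iff.2 (Or.inr ⟨rfl, hk'⟩))
  have hbelow : ∀ j' k', j < j' → ¬ HasConflict M j' k' := fun j' k' hj' hc =>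
    hmin (toLex (OrderDual.toDual j', k')) hc (Prod.Lex.lt_iff.2 (Or.inl hj'))
  obtain ⟨hne, ⟨k', hk', hk0⟩ | ⟨j', hj', hj0⟩⟩ := hp
  · obtain ⟨u, hu⟩ := exists_U_eq_transvection hk' (-(M j k / M j k'))
    -- A nonzero entry below `(j, k')` would be a conflict before `(j, k)`. So adding a multiple of
    -- column `k'` to column `k` leaves the rows below `j` alone.
    have hcol : ∀ j', j < j' → M j' k' = 0 := fun j' hj' => by
      by_contra h
      exact hrow k' hk' ⟨hk0, Or.inr ⟨j', hj', h⟩⟩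
    refine ⟨1, u, zeroPattern_lt hne ?_ (fun j' m hj' => ?_) fun m hm => ?_⟩ <;>
      rw [hu] <;> simp only [OneMemClass.coe_one, Units.val_one, one_mul]
    · rw [Matrix.mul_transvection_apply_same]
      field_simp
      ring
    · by_cases hm : m = k
      · rw [hm, Matrix.mul_transvection_apply_same, hcol j' hj', mul_zero, add_zero]
      · rw [Matrix.mul_transvection_apply_of_ne _ _ _ _ hm]
    · rw [Matrix.mul_transvection_apply_of_ne _ _ _ _ hm.ne]
  · obtain ⟨u, hu⟩ := exists_U_eq_transvection hj' (-(M j k / M j' k))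
    -- A nonzero entry to the left of `(j', k)` would be a conflict in a lower row. So adding a
    -- multiple of row `j'` to row `j` leaves the entries of row `j` left of `k` alone.
    have hrow' : ∀ m < k, M j' m = 0 := fun m hm => by
      by_contra h
      exact hbelow j' k hj' ⟨hj0, Or.inl ⟨m, hm, h⟩⟩
    refine ⟨u, 1, zeroPattern_lt hne ?_ (fun i m hi => ?_) fun m hm => ?_⟩ <;>
      rw [hu] <;> simp only [OneMemClass.coe_one, Units.val_one, mul_one]
    · rw [Matrix.transvection_mul_apply_same]
      field_simp
      ring
    · rw [Matrix.transvection_mul_apply_of_ne _ _ _ _ hi.ne']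
    · rw [Matrix.transvection_mul_apply_same, hrow' m hm, mul_zero, add_zero]

/-- Each matrix is brought by row and column operations to a matrix with at most one nonzero entry
in each row and in each column. -/
theorem exists_reduced [Finite F] (N : Matrix K K F) :
    ∃ g h : U K F, (∀ j k k', (g.1.1 * N * h.1.1) j k ≠ 0 → (g.1.1 * N * h.1.1) j k' ≠ 0 → k = k') ∧
      ∀ j j' k, (g.1.1 * N * h.1.1) j k ≠ 0 → (g.1.1 * N * h.1.1) j' k ≠ 0 → j = j' := by
  obtain ⟨⟨g, h⟩, hmin⟩ :=
    Finite.exists_min fun p : U K F × U K F => zeroPattern (p.1.1.1 * N * p.2.1.1)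
  have hno : ∀ j k, ¬ HasConflict (g.1.1 * N * h.1.1) j k := fun j k hc => by
    obtain ⟨g', h', hlt⟩ := exists_zeroPattern_lt hc
    refine not_le_of_gt hlt ?_
    have := hmin (g' * g, h * h')
    simpa only [Subgroup.coe_mul, Units.val_mul, Matrix.mul_assoc] using this
  refine ⟨g, h, fun j k k' hk hk' => ?_, fun j j' k hj hj' => ?_⟩
  · rcases lt_trichotomy k k' with hlt | heq | hlt
    · exact (hno j k' ⟨hk', Or.inl ⟨k, hlt, hk⟩⟩).elim
    · exact heq
    · exact (hno j k ⟨hk, Or.inl ⟨k', hlt, hk'⟩⟩).elim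
  · rcases lt_trichotomy j j' with hlt | heq | hlt
    · exact (hno j k ⟨hj, Or.inr ⟨j', hlt, hj'⟩⟩).elim
    · exact heq
    · exact (hno j' k ⟨hj', Or.inr ⟨j, hlt, hj⟩⟩).elim

/-- A strictly upper triangular matrix with at most one nonzero entry in each row and in each
column comes from a set partition. -/
theorem exists_arcMatrix_eq {M : Matrix K K F} (hM : IsStrictUpper M)
    (hrow : ∀ j k k', M j k ≠ 0 → M j k' ≠ 0 → k = k')
    (hcol : ∀ j j' k, M j k ≠ 0 → M j' k ≠ 0 → j = j') :
    ∃ mu : Multiset (Arc F), IsSetPartition K mu ∧ arcMatrix K mu = M := by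
  let S := {p : K × K // M p.1 p.2 ≠ 0}
  have hlt : ∀ p : S, p.1.1 < p.1.2 := fun p => by
    by_contra h
    exact p.2 (hM _ _ (not_lt.1 h))
  let f : S → Arc F := fun p => ⟨p.1.1, p.1.2, M p.1.1 p.1.2, hlt p, p.2⟩
  refine ⟨(univ : Finset S).val.map f, ⟨?_, ?_, ?_⟩, ?_⟩
  · intro α hα
    obtain ⟨p, -, rfl⟩ := Multiset.mem_map.1 hα
    exact ⟨p.1.1.2, p.1.2.2⟩
  · rw [Multiset.map_map]
    refine univ.nodup.map fun p p' h => ?_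
    have h1 : p.1.1 = p'.1.1 := Subtype.ext h
    refine Subtype.ext (Prod.ext h1 (hrow p.1.1 _ _ p.2 ?_))
    rw [h1]
    exact p'.2
  · rw [Multiset.map_map]
    refine univ.nodup.map fun p p' h => ?_
    have h1 : p.1.2 = p'.1.2 := Subtype.ext h
    refine Subtype.ext (Prod.ext (hcol _ _ p.1.2 p.2 ?_) h1)
    rw [h1]
    exact p'.2
  · ext j k
    rw [arcMatrix, Matrix.of_apply, wt, arcsBetween, Multiset.filter_map, Multiset.map_map]
    have h1 : ((univ : Finset S).val.filter
        ((fun α : Arc F => α.left = j ∧ α.right = k) ∘ f)) =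
        (univ.filter fun p : S => p.1 = (j, k)).val := by
      rw [Finset.filter_val]
      refine Multiset.filter_congr fun p _ => ?_
      exact ⟨fun h => Prod.ext (Subtype.ext h.1) (Subtype.ext h.2), fun h =>
        ⟨congrArg (fun q : K × K => (q.1 : ℕ+)) h, congrArg (fun q : K × K => (q.2 : ℕ+)) h⟩⟩
    rw [h1]
    change ∑ p ∈ univ.filter (fun p : S => p.1 = (j, k)), M p.1.1 p.1.2 = M j k
    by_cases h0 : M j k = 0
    · rw [h0]
      refine Finset.sum_eq_zero fun p hp => ?_
      rw [(Finset.mem_filter.1 hp).2, h0]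
    · rw [Finset.sum_eq_single_of_mem (⟨(j, k), h0⟩ : S) (by simp)]
      intro p hp hne
      exact (hne (Subtype.ext (Finset.mem_filter.1 hp).2)).elim

theorem exists_indexesSuperclass [Finite F] (u : U K F) : ∃ mu, IndexesSuperclass K mu u := by
  obtain ⟨g, h, hrow, hcol⟩ := exists_reduced (u.1.1 - 1)
  obtain ⟨mu, hmu, hM⟩ := exists_arcMatrix_eq
    (((isStrictUpper_sub_one u).mul_left g).mul_right h) hrow hcol
  refine ⟨mu, hmu, g⁻¹, h⁻¹, ?_⟩
  rw [hM]
  have h1 : (g⁻¹).1.1 * (g.1.1 * (u.1.1 - 1) * h.1.1) * (h⁻¹).1.1 = u.1.1 - 1 := by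
    have hg : (g⁻¹).1.1 * g.1.1 = 1 := by
      rw [← Units.val_mul, ← Subgroup.coe_mul, inv_mul_cancel]; rfl
    have hh : h.1.1 * (h⁻¹).1.1 = 1 := by
      rw [← Units.val_mul, ← Subgroup.coe_mul, mul_inv_cancel]; rfl
    calc _ = ((g⁻¹).1.1 * g.1.1) * (u.1.1 - 1) * (h.1.1 * (h⁻¹).1.1) := by
          simp only [Matrix.mul_assoc]
      _ = _ := by rw [hg, hh, one_mul, mul_one]
  rw [h1]
  abel

/-- Existence is enough: the formula `arcChar_eq` holds for whichever index is chosen, so uniqueness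
is never needed. -/
theorem superclassIndex_spec [Finite F] (u : U K F) :
    IndexesSuperclass K (superclassIndex K u) u :=
  Classical.epsilon_spec (exists_indexesSuperclass u)

end Reduction

/-! ### The character of an arc as a normalized sum over pairs. -/

section ArcValue

open Finset Matrix
open scoped Classical

variable {K : Finset ℕ+} {F : Type*} [Field F]

theorem IsSetPartition.eq_of_left {mu : Multiset (Arc F)} (h : IsSetPartition K mu) {β γ : Arc F}
    (hβ : β ∈ mu) (hγ : γ ∈ mu) (hl : β.left = γ.left) : β = γ :=
  Multiset.inj_on_of_nodup_map h.2.1 _ hβ _ hγ hl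

theorem IsSetPartition.eq_of_right {mu : Multiset (Arc F)} (h : IsSetPartition K mu) {β γ : Arc F}
    (hβ : β ∈ mu) (hγ : γ ∈ mu) (hr : β.right = γ.right) : β = γ :=
  Multiset.inj_on_of_nodup_map h.2.2 _ hβ _ hγ hr

theorem IsSetPartition.wt_eq {mu : Multiset (Arc F)} (h : IsSetPartition K mu) {β : Arc F}
    (hβ : β ∈ mu) : wt mu β.left β.right = β.label := by
  have h1 : arcsBetween mu β.left β.right = {β} := by
    refine (Multiset.Nodup.ext (h.2.1.of_map.filter _) (Multiset.nodup_singleton β)).2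
      fun γ => ?_
    rw [Multiset.mem_filter, Multiset.mem_singleton]
    exact ⟨fun hγ => h.eq_of_left hγ.1 hβ hγ.2.1, by rintro rfl; exact ⟨hβ, rfl, rfl⟩⟩
  rw [wt, h1, Multiset.map_singleton, Multiset.sum_singleton]

theorem IsSetPartition.arcMatrix_ne_zero_iff {mu : Multiset (Arc F)} (h : IsSetPartition K mu)
    {j k : K} : arcMatrix K mu j k ≠ 0 ↔ ∃ β ∈ mu, β.left = j ∧ β.right = k := by
  constructor
  · intro h1
    by_contra h2
    push Not at h2
    refine h1 ?_
    have h3 : arcsBetween mu (j : ℕ+) (k : ℕ+) = 0 :=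
      Multiset.filter_eq_nil.2 fun β hβ hc => h2 β hβ hc.1 hc.2
    rw [arcMatrix, Matrix.of_apply, wt, h3, Multiset.map_zero, Multiset.sum_zero]
  · rintro ⟨β, hβ, hj, hk⟩
    rw [arcMatrix, Matrix.of_apply, ← hj, ← hk, h.wt_eq hβ]
    exact β.label_ne_zero

theorem IsSetPartition.arcMatrix_row {mu : Multiset (Arc F)} (h : IsSetPartition K mu) {j k k' : K}
    (hk : arcMatrix K mu j k ≠ 0) (hk' : k' ≠ k) : arcMatrix K mu j k' = 0 := by
  by_contra h0
  obtain ⟨β, hβ, hj, hr⟩ := h.arcMatrix_ne_zero_iff.1 hk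
  obtain ⟨γ, hγ, hj', hr'⟩ := h.arcMatrix_ne_zero_iff.1 h0
  have := h.eq_of_left hβ hγ (hj.trans hj'.symm)
  subst this
  exact hk' (Subtype.ext (hr'.symm.trans hr))

theorem IsSetPartition.arcMatrix_col {mu : Multiset (Arc F)} (h : IsSetPartition K mu) {j j' k : K}
    (hj : arcMatrix K mu j k ≠ 0) (hj' : j' ≠ j) : arcMatrix K mu j' k = 0 := by
  by_contra h0
  obtain ⟨β, hβ, hl, hr⟩ := h.arcMatrix_ne_zero_iff.1 hj
  obtain ⟨γ, hγ, hl', hr'⟩ := h.arcMatrix_ne_zero_iff.1 h0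
  have := h.eq_of_right hβ hγ (hr.trans hr'.symm)
  subst this
  exact hj' (Subtype.ext (hl'.symm.trans hl))

theorem IsSetPartition.arcMatrix_mulVec {mu : Multiset (Arc F)} (h : IsSetPartition K mu) {j k : K}
    (hk : arcMatrix K mu j k ≠ 0) (y : K → F) :
    (arcMatrix K mu *ᵥ y) j = arcMatrix K mu j k * y k :=
  Finset.sum_eq_single k (fun k' _ hk' => by
    dsimp only; rw [h.arcMatrix_row hk hk', zero_mul]) (by simp)

theorem IsSetPartition.arcMatrix_vecMul {mu : Multiset (Arc F)} (h : IsSetPartition K mu) {j k : K}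
    (hj : arcMatrix K mu j k ≠ 0) (x : K → F) :
    (x ᵥ* arcMatrix K mu) k = x j * arcMatrix K mu j k :=
  Finset.sum_eq_single j (fun j' _ hj' => by
    dsimp only; rw [h.arcMatrix_col hj hj', mul_zero]) (by simp)

/-- The number of the arcs of `mu` that are nested in `i ⌢ l` is a number of matrix columns. -/
theorem IsSetPartition.card_nested {mu : Multiset (Arc F)} (h : IsSetPartition K mu) (i l : K) :
    Multiset.card (mu.filter fun β => (i : ℕ+) < β.left ∧ β.right < (l : ℕ+)) =
      #{k : K | k < l ∧ ∃ j, i < j ∧ arcMatrix K mu j k ≠ 0} := by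
  rw [← Multiset.card_map Arc.right, ← Finset.card_map (Function.Embedding.subtype _),
    Finset.card_def]
  congr 1
  refine (Multiset.Nodup.ext
    (Multiset.nodup_of_le (Multiset.map_le_map (Multiset.filter_le _ mu)) h.2.2) (Finset.nodup _)).2 fun k => ?_
  simp only [Multiset.mem_map, Multiset.mem_filter, Finset.mem_val, Finset.mem_map,
    Finset.mem_filter, Finset.mem_univ, true_and, Function.Embedding.subtype_apply]
  constructor
  · rintro ⟨β, ⟨hβ, hi, hl⟩, rfl⟩
    obtain ⟨hL, hR⟩ := h.1 β hβ
    exact ⟨⟨β.right, hR⟩, ⟨hl, ⟨β.left, hL⟩, hi, h.arcMatrix_ne_zero_iff.2 ⟨β, hβ, rfl, rfl⟩⟩, rfl⟩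
  · rintro ⟨k, ⟨hkl, j, hij, hM⟩, rfl⟩
    obtain ⟨β, hβ, hj, hk⟩ := h.arcMatrix_ne_zero_iff.1 hM
    exact ⟨β, ⟨hβ, hj ▸ hij, hk ▸ hkl⟩, hk⟩

variable [Fintype F]

/-- The degree `q ^ #{j | i < j < l}` of the character of an arc `i ⌢ l`,
divided by the number of pairs of vectors in `pairSum`. -/
noncomputable def pairNorm (F : Type*) [Field F] [Fintype F] {K : Finset ℕ+} (i l : K) : ℂ :=
  (Fintype.card F : ℂ) ^ #{j : K | i < j ∧ j < l} *
    ((#(rowVecs i (1 : F)) : ℂ) * #(colVecs l (1 : F)))⁻¹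

theorem card_between (i l : K) :
    (K.filter fun j => (i : ℕ+) < j ∧ j < (l : ℕ+)).card = #{j : K | i < j ∧ j < l} := by
  rw [← Finset.card_map (Function.Embedding.subtype _)]
  congr 1
  ext k
  simp only [Finset.mem_filter, Finset.mem_map, Finset.mem_univ, true_and,
    Function.Embedding.subtype_apply]
  exact ⟨fun h => ⟨⟨k, h.1⟩, h.2, rfl⟩, by rintro ⟨k, h, rfl⟩; exact ⟨k.2, h⟩⟩

theorem card_rowVecs (i : K) (c : F) : #(rowVecs i c) = Fintype.card F ^ #{j : K | i < j} := by
  simp [rowVecs, card_agreeOn]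

theorem card_colVecs (l : K) (c : F) : #(colVecs l c) = Fintype.card F ^ #{k : K | k < l} := by
  simp [colVecs, card_agreeOn]

theorem card_field_ne_zero : (Fintype.card F : ℂ) ≠ 0 := Nat.cast_ne_zero.2 Fintype.card_ne_zero

/-- This is the nonvanishing case of the character formula. After summation over `x`, each nonzero
entry `(j, k)` with `i < j` forces `y k = 0`; the surviving `y` all give the same value of `θ`. -/
theorem pairSum_arcMatrix_of_free {θ : AddChar F ℂ} (hθ : θ ≠ 1) {a : F} (ha : a ≠ 0) (i l : K)
    {mu : Multiset (Arc F)} (h : IsSetPartition K mu)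
    (hrow : ∀ k < l, arcMatrix K mu i k = 0) (hcol : ∀ j, i < j → arcMatrix K mu j l = 0) :
    pairSum θ a i l 1 1 (arcMatrix K mu) = #(rowVecs i (1 : F)) *
      ((Fintype.card F : ℂ) ^ #{k : K | k < l ∧ ¬ ∃ j, i < j ∧ arcMatrix K mu j k ≠ 0} *
        θ (a * wt mu i l)) := by
  rw [pairSum_eq_sum_col hθ ha, ← Finset.sum_filter]
  congr 1
  have h1 : (colVecs l (1 : F)).filter (fun y => ∀ j, i < j → (arcMatrix K mu *ᵥ y) j = 0) =
      agreeOn (fun k => l ≤ k ∨ ∃ j, i < j ∧ arcMatrix K mu j k ≠ 0) (Pi.single l 1) := by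
    ext y
    rw [Finset.mem_filter, colVecs, mem_agreeOn, mem_agreeOn]
    constructor
    · rintro ⟨h1, h2⟩ k (hk | ⟨j, hij, hM⟩)
      · exact h1 k hk
      · have h3 := h2 j hij
        rw [h.arcMatrix_mulVec hM] at h3
        -- The forced coordinate is never `l`, where the entry of `y` is fixed to be 1.
        have hkl : k ≠ l := fun hkl => hM (hkl ▸ hcol j hij)
        rw [(mul_eq_zero.1 h3).resolve_left hM, Pi.single_eq_of_ne hkl]
    · refine fun h1 => ⟨fun k hk => h1 k (Or.inl hk), fun j hij => ?_⟩
      refine Finset.sum_eq_zero fun k _ => ?_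
      by_cases hM : arcMatrix K mu j k = 0
      · dsimp only
        rw [hM, zero_mul]
      · have hkl : k ≠ l := fun hkl => hM (hkl ▸ hcol j hij)
        rw [h1 k (Or.inr ⟨j, hij, hM⟩), Pi.single_eq_of_ne hkl, mul_zero]
  have h2 : ∀ y ∈ (colVecs l (1 : F)).filter (fun y => ∀ j, i < j → (arcMatrix K mu *ᵥ y) j = 0),
      θ (a * (1 * (arcMatrix K mu *ᵥ y) i)) = θ (a * wt mu i l) := by
    intro y hy
    obtain ⟨hy1, hy2⟩ := mem_colVecs.1 (Finset.mem_filter.1 hy).1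
    have h3 : (arcMatrix K mu *ᵥ y) i = arcMatrix K mu i l * y l :=
      Finset.sum_eq_single l (fun k _ hk => by
        rcases lt_or_gt_of_ne hk with hk | hk
        · dsimp only
          rw [hrow k hk, zero_mul]
        · rw [hy2 k hk, mul_zero]) (by simp)
    rw [h3, hy1, one_mul, mul_one]
    rfl
  rw [Finset.sum_congr rfl h2, Finset.sum_const, nsmul_eq_mul, h1, card_agreeOn]
  push_cast
  simp only [not_or, not_le]

theorem arcValue_eq {θ : AddChar F ℂ} (hθ : θ ≠ 1) (α : Arc F) (i l : K) (hi : α.left = i)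
    (hl : α.right = l) {mu : Multiset (Arc F)} (h : IsSetPartition K mu) :
    arcValue θ K α mu = pairNorm F i l * pairSum θ α.label i l 1 1 (arcMatrix K mu) := by
  rw [arcValue, hi, hl]
  split_ifs with hc
  · obtain ⟨β, hβ, ⟨h1, h2⟩ | ⟨h1, h2⟩⟩ := hc
    · have hM : arcMatrix K mu i ⟨β.right, (h.1 β hβ).2⟩ ≠ 0 :=
        h.arcMatrix_ne_zero_iff.2 ⟨β, hβ, h1.symm, rfl⟩
      -- Summing over `y` first requires `x N` to vanish before `l`, but its entry at `β.right` is
      -- the label of `β`, because `x` has entry 1 at `i`. The other vanishing case is dual.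
      rw [pairSum_eq_sum_row hθ α.label_ne_zero, Finset.sum_eq_zero, mul_zero, mul_zero]
      refine fun x hx => if_neg fun h3 => ?_
      have h4 := h3 ⟨β.right, (h.1 β hβ).2⟩ h2
      rw [h.arcMatrix_vecMul hM, (mem_rowVecs.1 hx).1, one_mul] at h4
      exact hM h4
    · have hM : arcMatrix K mu ⟨β.left, (h.1 β hβ).1⟩ l ≠ 0 :=
        h.arcMatrix_ne_zero_iff.2 ⟨β, hβ, rfl, h2⟩
      rw [pairSum_eq_sum_col hθ α.label_ne_zero, Finset.sum_eq_zero, mul_zero, mul_zero]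
      refine fun y hy => if_neg fun h3 => ?_
      have h4 := h3 ⟨β.left, (h.1 β hβ).1⟩ h1
      rw [h.arcMatrix_mulVec hM, (mem_colVecs.1 hy).1, mul_one] at h4
      exact hM h4
  · push Not at hc
    rw [pairSum_arcMatrix_of_free hθ α.label_ne_zero i l h, pairNorm, card_between, h.card_nested,
      card_colVecs]
    · have h1 : #{k : K | k < l} = #{k : K | k < l ∧ ∃ j, i < j ∧ arcMatrix K mu j k ≠ 0} +
          #{k : K | k < l ∧ ¬ ∃ j, i < j ∧ arcMatrix K mu j k ≠ 0} := by
        rw [← Finset.card_filter_add_card_filter_not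
          (s := ({k : K | k < l} : Finset K))
          (fun k => ∃ j, i < j ∧ arcMatrix K mu j k ≠ 0), Finset.filter_filter,
          Finset.filter_filter]
      rw [h1, pow_add]
      push_cast
      have h2 : (#(rowVecs i (1 : F)) : ℂ) ≠ 0 := card_agreeOn_ne_zero _ _
      have h3 := card_field_ne_zero (F := F)
      field_simp
    · intro k hk
      by_contra hM
      obtain ⟨β, hβ, hj, hr⟩ := h.arcMatrix_ne_zero_iff.1 hM
      exact (hc β hβ).1 hj.symm |>.not_gt (hr ▸ hk)
    · intro j hj
      by_contra hM
      obtain ⟨β, hβ, hj', hr⟩ := h.arcMatrix_ne_zero_iff.1 hM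
      exact (hc β hβ).2 (hj' ▸ hj) hr

theorem arcChar_eq {θ : AddChar F ℂ} (hθ : θ ≠ 1) (α : Arc F) (i l : K) (hi : α.left = i)
    (hl : α.right = l) (u : U K F) :
    arcChar θ K α u = pairNorm F i l * pairSum θ α.label i l 1 1 (u.1.1 - 1) := by
  obtain ⟨hmu, x, y, hxy⟩ := superclassIndex_spec u
  rw [arcChar, arcValue_eq hθ α i l hi hl hmu, hxy, add_sub_cancel_left, pairSum_mul_mul]

end ArcValue

/-! ### Removing the hollow endpoints by dual shears. -/

section Alternating

open Finset Matrix
open scoped Classical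

variable {K : Finset ℕ+} {F : Type*} [Field F] {ι : Type*}

/-- A family of arcs, with left endpoints `i`, right endpoints `l` and labels `a`, in which each
arc has exactly one endpoint on the top of its stack: the right one if `A` holds, and the left one
otherwise. -/
structure IsAlternating (i l : ι → K) (a : ι → F) (A : ι → Prop) : Prop where
  label_ne_zero : ∀ α, a α ≠ 0
  right_inj : ∀ α α', A α → A α' → l α = l α' → α = α'
  left_inj : ∀ β β', ¬ A β → ¬ A β' → i β = i β' → β = β'
  exists_left : ∀ α, A α → ∃ β, ¬ A β ∧ i β = i α
  exists_right : ∀ β, ¬ A β → ∃ α, A α ∧ l α = l β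
  right_le : ∀ α β, A α → ¬ A β → i α = i β → l α ≤ l β
  left_le : ∀ α β, A α → ¬ A β → l α = l β → i α ≤ i β
  add_eq_zero : ∀ α β, A α → ¬ A β → i α = i β → l α = l β → a α + a β = 0

/-- The matrix of the substitution of the row vectors that removes the hollow left endpoints. -/
noncomputable def shearLeft (i l : ι → K) (a : ι → F) (A : ι → Prop) : Matrix ι ι F :=
  Matrix.of fun α β =>
    if A α ∧ ¬ A β then if i α = i β then 1 else if l α = l β then -(a β / a α) else 0 else 0

/-- The matrix of the substitution of the column vectors that is dual to `shearLeft`. -/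
noncomputable def shearRight (i l : ι → K) (a : ι → F) (A : ι → Prop) : Matrix ι ι F :=
  Matrix.of fun β α => -(a α / a β) * shearLeft i l a A α β

variable {i l : ι → K} {a : ι → F} {A : ι → Prop}

theorem shearLeft_ne_zero {α β : ι} (h : shearLeft i l a A α β ≠ 0) :
    A α ∧ ¬ A β ∧ (i α = i β ∨ l α = l β) := by
  rw [shearLeft, Matrix.of_apply] at h
  split_ifs at h with h1 h2 h3
  · exact ⟨h1.1, h1.2, Or.inl h2⟩
  · exact ⟨h1.1, h1.2, Or.inr h3⟩
  · exact (h rfl).elim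
  · exact (h rfl).elim

/-- These inequalities keep the substitution within the supports: the row vector of `β` may be added
to that of `α`, and the column vector of `α` to that of `β`. -/
theorem IsAlternating.le_of_shearLeft_ne_zero (H : IsAlternating i l a A) {α β : ι}
    (h : shearLeft i l a A α β ≠ 0) : i α ≤ i β ∧ l α ≤ l β := by
  obtain ⟨h1, h2, h3 | h3⟩ := shearLeft_ne_zero h
  · exact ⟨h3.le, H.right_le α β h1 h2 h3⟩
  · exact ⟨H.left_le α β h1 h2 h3, h3.le⟩

theorem shearRight_ne_zero {α β : ι} (h : shearRight i l a A β α ≠ 0) :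
    shearLeft i l a A α β ≠ 0 := fun h0 => h (by rw [shearRight, Matrix.of_apply, h0, mul_zero])

/-- When only the right ends agree, the entry of `shearLeft` was chosen to give 1. For parallel arcs
that entry is already 1 because of the left ends, and `a α + a β = 0` is needed. -/
theorem IsAlternating.shearRight_eq_one (H : IsAlternating i l a A) {α β : ι} (hα : A α)
    (hβ : ¬ A β) (hl : l α = l β) : shearRight i l a A β α = 1 := by
  have h1 := H.label_ne_zero α
  have h2 := H.label_ne_zero β
  rw [shearRight, Matrix.of_apply, shearLeft, Matrix.of_apply, if_pos ⟨hα, hβ⟩]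
  split_ifs with h3
  · rw [eq_neg_of_add_eq_zero_left (H.add_eq_zero α β hα hβ h3 hl)]
    field_simp
  · field_simp

variable [Fintype ι]

theorem shearLeft_mul_self : shearLeft i l a A * shearLeft i l a A = 0 := by
  ext α γ
  rw [Matrix.mul_apply, Matrix.zero_apply]
  refine Finset.sum_eq_zero fun β _ => ?_
  by_contra h
  exact (shearLeft_ne_zero (left_ne_zero_of_mul h)).2.1
    (shearLeft_ne_zero (right_ne_zero_of_mul h)).1

theorem shearRight_mul_self : shearRight i l a A * shearRight i l a A = 0 := by
  ext α γ
  rw [Matrix.mul_apply, Matrix.zero_apply]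
  refine Finset.sum_eq_zero fun β _ => ?_
  by_contra h
  exact (shearLeft_ne_zero (shearRight_ne_zero (right_ne_zero_of_mul h))).2.1
    (shearLeft_ne_zero (shearRight_ne_zero (left_ne_zero_of_mul h))).1

/-- By the choice of `shearRight`, its transpose passes through `diagonal a` as minus `shearLeft`,
and `(1 - S) * (1 + S) = 1` when `S` squares to zero. -/
theorem IsAlternating.shear_form (H : IsAlternating i l a A) :
    (1 + shearRight i l a A)ᵀ * diagonal a * (1 + shearLeft i l a A) = diagonal a := by
  have h1 : (shearRight i l a A)ᵀ * diagonal a = -(diagonal a * shearLeft i l a A) := by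
    ext α β
    have h2 := H.label_ne_zero β
    rw [Matrix.mul_diagonal, Matrix.neg_apply, Matrix.diagonal_mul, Matrix.transpose_apply,
      shearRight, Matrix.of_apply]
    field_simp
  rw [Matrix.transpose_add, Matrix.transpose_one, add_mul, one_mul, h1, mul_add, mul_one, add_mul,
    neg_mul, Matrix.mul_assoc, shearLeft_mul_self, mul_zero]
  abel

theorem sum_mul_dotProduct_eq_trace (a : ι → F) (X Y : Matrix ι K F) (N : Matrix K K F) :
    ∑ α, a α * (X α ⬝ᵥ (N *ᵥ Y α)) = (diagonal a * X * N * Yᵀ).trace := by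
  refine Finset.sum_congr rfl fun α _ => ?_
  rw [Matrix.diag_apply, Matrix.mul_assoc, Matrix.mul_assoc, Matrix.diagonal_mul]
  rfl

theorem IsAlternating.trace_shear (H : IsAlternating i l a A) (X Y : Matrix ι K F)
    (N : Matrix K K F) :
    (diagonal a * ((1 + shearLeft i l a A) * X) * N * ((1 + shearRight i l a A) * Y)ᵀ).trace =
      (diagonal a * X * N * Yᵀ).trace := by
  have h : ∀ S : Matrix ι ι F, S * (diagonal a * ((1 + shearLeft i l a A) * X) * N * Yᵀ) =
      S * diagonal a * (1 + shearLeft i l a A) * X * N * Yᵀ := fun S => by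
    simp only [Matrix.mul_assoc]
  rw [Matrix.transpose_mul, ← Matrix.mul_assoc, Matrix.trace_mul_comm, h, H.shear_form]

variable [Fintype F]

theorem add_mem_rowVecs {i : K} {c d : F} {x y : K → F} (hx : x ∈ rowVecs i c)
    (hy : y ∈ rowVecs i d) : x + y ∈ rowVecs i (c + d) := by
  rw [mem_rowVecs] at *
  exact ⟨by simp [hx.1, hy.1], fun j hj => by simp [hx.2 j hj, hy.2 j hj]⟩

theorem add_mem_colVecs {i : K} {c d : F} {x y : K → F} (hx : x ∈ colVecs i c)
    (hy : y ∈ colVecs i d) : x + y ∈ colVecs i (c + d) := by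
  rw [mem_colVecs] at *
  exact ⟨by simp [hx.1, hy.1], fun j hj => by simp [hx.2 j hj, hy.2 j hj]⟩

theorem neg_mem_rowVecs {i : K} {c : F} {x : K → F} (hx : x ∈ rowVecs i c) :
    -x ∈ rowVecs i (-c) := by
  rw [mem_rowVecs] at *
  exact ⟨by simp [hx.1], fun j hj => by simp [hx.2 j hj]⟩

theorem neg_mem_colVecs {i : K} {c : F} {x : K → F} (hx : x ∈ colVecs i c) :
    -x ∈ colVecs i (-c) := by
  rw [mem_colVecs] at *
  exact ⟨by simp [hx.1], fun j hj => by simp [hx.2 j hj]⟩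

/-- At a hollow left end exactly one added vector has a nonzero leading entry at that node, namely
that of the solid end on the same stack. All others begin strictly further right, so the leading
entry shifts by exactly 1. -/
theorem IsAlternating.shearLeft_mul_mem (H : IsAlternating i l a A) {X : Matrix ι K F} {c : ι → F}
    (hX : ∀ α, X α ∈ rowVecs (i α) (c α)) (hc : ∀ β, ¬ A β → c β = 1) (α : ι) :
    (shearLeft i l a A * X) α ∈ rowVecs (i α) (if A α then 1 else 0) := by
  refine mem_rowVecs.2 ⟨?_, fun j hj => ?_⟩
  · rw [Matrix.mul_apply]
    split_ifs with hα
    · obtain ⟨β, hβ, hi⟩ := H.exists_left α hα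
      rw [Finset.sum_eq_single β ?_ (by simp)]
      · rw [← hi, (mem_rowVecs.1 (hX β)).1, hc β hβ, shearLeft, Matrix.of_apply,
          if_pos ⟨hα, hβ⟩, if_pos hi.symm, one_mul]
      · intro γ _ hγ
        by_contra h
        have h1 := left_ne_zero_of_mul h
        have h2 := (shearLeft_ne_zero h1).2.1
        rcases (H.le_of_shearLeft_ne_zero h1).1.eq_or_lt with h3 | h3
        · exact hγ (H.left_inj γ β h2 hβ (h3.symm.trans hi.symm))
        · exact right_ne_zero_of_mul h ((mem_rowVecs.1 (hX γ)).2 _ h3)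
    · refine Finset.sum_eq_zero fun β _ => ?_
      by_contra h
      exact hα (shearLeft_ne_zero (left_ne_zero_of_mul h)).1
  · rw [Matrix.mul_apply]
    refine Finset.sum_eq_zero fun β _ => ?_
    by_contra h
    exact right_ne_zero_of_mul h ((mem_rowVecs.1 (hX β)).2 _
      (hj.trans_le (H.le_of_shearLeft_ne_zero (left_ne_zero_of_mul h)).1))

theorem IsAlternating.shearRight_mul_mem (H : IsAlternating i l a A) {Y : Matrix ι K F}
    {d : ι → F} (hY : ∀ α, Y α ∈ colVecs (l α) (d α)) (hd : ∀ α, A α → d α = 1) (β : ι) :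
    (shearRight i l a A * Y) β ∈ colVecs (l β) (if A β then 0 else 1) := by
  refine mem_colVecs.2 ⟨?_, fun k hk => ?_⟩
  · rw [Matrix.mul_apply]
    split_ifs with hβ
    · refine Finset.sum_eq_zero fun α _ => ?_
      by_contra h
      exact (shearLeft_ne_zero (shearRight_ne_zero (left_ne_zero_of_mul h))).2.1 hβ
    · obtain ⟨α, hα, hl⟩ := H.exists_right β hβ
      rw [Finset.sum_eq_single α ?_ (by simp)]
      · rw [H.shearRight_eq_one hα hβ hl, ← hl, (mem_colVecs.1 (hY α)).1, hd α hα, one_mul]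
      · intro γ _ hγ
        by_contra h
        have h1 := shearRight_ne_zero (left_ne_zero_of_mul h)
        have h2 := (shearLeft_ne_zero h1).1
        rcases (H.le_of_shearLeft_ne_zero h1).2.eq_or_lt with h3 | h3
        · exact hγ (H.right_inj γ α h2 hα (h3.trans hl.symm))
        · exact right_ne_zero_of_mul h ((mem_colVecs.1 (hY γ)).2 _ h3)
  · rw [Matrix.mul_apply]
    refine Finset.sum_eq_zero fun α _ => ?_
    by_contra h
    exact right_ne_zero_of_mul h ((mem_colVecs.1 (hY α)).2 _
      ((H.le_of_shearLeft_ne_zero (shearRight_ne_zero (left_ne_zero_of_mul h))).2.trans_lt hk))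

omit [Fintype ι] [Fintype F] in
theorem addChar_map_sum (θ : AddChar F ℂ) (s : Finset ι) (f : ι → F) :
    θ (∑ α ∈ s, f α) = ∏ α ∈ s, θ (f α) := by
  have h := map_prod θ.toMonoidHom (fun α => Multiplicative.ofAdd (f α)) s
  rw [← ofAdd_sum] at h
  exact h

theorem prod_pairSum (θ : AddChar F ℂ) (a : ι → F) (i l : ι → K) (c d : ι → F)
    (N : Matrix K K F) :
    ∏ α, pairSum θ (a α) (i α) (l α) (c α) (d α) N =
      ∑ X ∈ Fintype.piFinset fun α => rowVecs (i α) (c α),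
        ∑ Y ∈ Fintype.piFinset fun α => colVecs (l α) (d α),
          θ (diagonal a * Matrix.of X * N * (Matrix.of Y)ᵀ).trace := by
  simp only [pairSum, Finset.prod_univ_sum]
  refine Finset.sum_congr rfl fun X _ => Finset.sum_congr rfl fun Y _ => ?_
  rw [← sum_mul_dotProduct_eq_trace, addChar_map_sum]
  rfl

omit [Fintype F] in
theorem one_sub_mul_one_add {t : Matrix ι ι F} (ht : t * t = 0) (X : Matrix ι K F) :
    (1 + t) * ((1 - t) * X) = X ∧ (1 - t) * ((1 + t) * X) = X := by
  rw [← Matrix.mul_assoc, ← Matrix.mul_assoc]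
  constructor <;> simp [add_mul, mul_add, sub_mul, mul_sub, ht]

/-- The hollow endpoints do not contribute to the product of the characters. -/
theorem IsAlternating.prod_pairSum_eq (H : IsAlternating i l a A) (θ : AddChar F ℂ)
    (N : Matrix K K F) :
    ∏ α, pairSum θ (a α) (i α) (l α) 1 1 N =
      ∏ α, pairSum θ (a α) (i α) (l α) (if A α then 0 else 1) (if A α then 1 else 0) N := by
  rw [prod_pairSum θ a i l (fun _ => 1) (fun _ => 1), prod_pairSum]
  -- Read from right to left, `1 + shearLeft` raises the leading entries at hollow left ends from 0
  -- to 1 and keeps those at solid ends; `1 + shearRight` does the same for the columns.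
  symm
  refine Finset.sum_nbij' (fun X => (1 + shearLeft i l a A) * Matrix.of X)
    (fun X => (1 - shearLeft i l a A) * Matrix.of X) ?_ ?_
    (fun X _ => (one_sub_mul_one_add shearLeft_mul_self X).2)
    (fun X _ => (one_sub_mul_one_add shearLeft_mul_self X).1) fun X _ => ?_
  · intro X hX
    rw [Fintype.mem_piFinset] at hX ⊢
    intro α
    have h1 := add_mem_rowVecs (hX α)
      (H.shearLeft_mul_mem (X := Matrix.of X) hX (fun β hβ => if_neg hβ) α)
    have h2 : (1 + shearLeft i l a A) * Matrix.of X = Matrix.of X + shearLeft i l a A * Matrix.of X := by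
      rw [Matrix.add_mul, Matrix.one_mul]
    change ((1 + shearLeft i l a A) * Matrix.of X : Matrix ι K F) α ∈ _
    rw [h2]
    convert h1 using 2
    · split_ifs <;> simp
    · rfl
  · intro X hX
    rw [Fintype.mem_piFinset] at hX ⊢
    intro α
    have h1 := add_mem_rowVecs (hX α) (neg_mem_rowVecs
      (H.shearLeft_mul_mem (X := Matrix.of X) hX (fun β hβ => rfl) α))
    rw [← sub_eq_add_neg] at h1
    have h2 : (1 - shearLeft i l a A) * Matrix.of X = Matrix.of X - shearLeft i l a A * Matrix.of X := by
      rw [Matrix.sub_mul, Matrix.one_mul]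
    change ((1 - shearLeft i l a A) * Matrix.of X : Matrix ι K F) α ∈ _
    rw [h2]
    convert h1 using 2
    · split_ifs <;> simp
    · exact sub_eq_add_neg _ _
  refine Finset.sum_nbij' (fun Y => (1 + shearRight i l a A) * Matrix.of Y)
    (fun Y => (1 - shearRight i l a A) * Matrix.of Y) ?_ ?_
    (fun Y _ => (one_sub_mul_one_add shearRight_mul_self Y).2)
    (fun Y _ => (one_sub_mul_one_add shearRight_mul_self Y).1) fun Y _ => ?_
  · intro Y hY
    rw [Fintype.mem_piFinset] at hY ⊢
    intro α
    have h1 := add_mem_colVecs (hY α)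
      (H.shearRight_mul_mem (Y := Matrix.of Y) hY (fun β hβ => if_pos hβ) α)
    have h2 : (1 + shearRight i l a A) * Matrix.of Y = Matrix.of Y + shearRight i l a A * Matrix.of Y := by
      rw [Matrix.add_mul, Matrix.one_mul]
    change ((1 + shearRight i l a A) * Matrix.of Y : Matrix ι K F) α ∈ _
    rw [h2]
    convert h1 using 2
    · split_ifs <;> simp
    · rfl
  · intro Y hY
    rw [Fintype.mem_piFinset] at hY ⊢
    intro α
    have h1 := add_mem_colVecs (hY α) (neg_mem_colVecs
      (H.shearRight_mul_mem (Y := Matrix.of Y) hY (fun β hβ => rfl) α))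
    rw [← sub_eq_add_neg] at h1
    have h2 : (1 - shearRight i l a A) * Matrix.of Y = Matrix.of Y - shearRight i l a A * Matrix.of Y := by
      rw [Matrix.sub_mul, Matrix.one_mul]
    change ((1 - shearRight i l a A) * Matrix.of Y : Matrix ι K F) α ∈ _
    rw [h2]
    convert h1 using 2
    · split_ifs <;> simp
    · exact sub_eq_add_neg _ _
  · exact congrArg θ (H.trace_shear X Y N).symm

end Alternating

/-! ### Counting the matrices that satisfy the linear conditions. -/

section Count

open Finset Matrix
open scoped Classical

variable {K : Finset ℕ+} {F : Type*} [Field F] {ι : Type*}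

/-- The linear condition on `N` that results from the summation over the vectors at the hollow end
of an arc, where `z` is the vector at its solid end, which is the right one if `P` holds. -/
def EndCondition (P : Prop) (i l : K) (z : K → F) (N : Matrix K K F) : Prop :=
  (P → ∀ j, i < j → (N *ᵥ z) j = 0) ∧ (¬ P → ∀ k, k < l → (z ᵥ* N) k = 0)

/-- The vectors at the solid end of an arc, which is the right one if `P` holds. -/
noncomputable def solidVecs (F : Type*) [Field F] [Fintype F] (P : Prop) (i l : K) :
    Finset (K → F) :=
  if P then colVecs l 1 else rowVecs i 1

/-- A position `(j, k)` at which the conditions force a zero entry. -/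
def IsForced (A : ι → Prop) (i l : ι → K) (j k : K) : Prop :=
  (∃ α, A α ∧ i α < j ∧ k = l α) ∨ ∃ β, ¬ A β ∧ j = i β ∧ k < l β

/-- The sum over the hollow end has leading entry 0, so no character value survives. The number of
its vectors does not depend on the leading entry and cancels against the norm, leaving the degree
times an average over the solid end. -/
theorem pairNorm_mul_pairSum [Fintype F] {θ : AddChar F ℂ} (hθ : θ ≠ 1) {a : F} (ha : a ≠ 0)
    (P : Prop) (i l : K) (N : Matrix K K F) :
    pairNorm F i l * pairSum θ a i l (if P then 0 else 1) (if P then 1 else 0) N =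
      (Fintype.card F : ℂ) ^ #{j : K | i < j ∧ j < l} * (#(solidVecs F P i l) : ℂ)⁻¹ *
        ∑ z ∈ solidVecs F P i l, if EndCondition P i l z N then 1 else 0 := by
  have hR : (#(rowVecs i (1 : F)) : ℂ) ≠ 0 := card_agreeOn_ne_zero _ _
  have hC : (#(colVecs l (1 : F)) : ℂ) ≠ 0 := card_agreeOn_ne_zero _ _
  by_cases hP : P
  · simp only [EndCondition, hP, solidVecs, if_true, true_implies, not_true_eq_false,
      false_implies, and_true]
    rw [pairSum_eq_sum_col hθ ha, card_rowVecs i 0, ← card_rowVecs i 1, pairNorm]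
    simp only [zero_mul, mul_zero, AddChar.map_zero_eq_one]
    field_simp
  · simp only [EndCondition, hP, solidVecs, if_false, true_implies, not_false_eq_true,
      false_implies, true_and]
    rw [pairSum_eq_sum_row hθ ha, card_colVecs l 0, ← card_colVecs l 1, pairNorm]
    simp only [zero_mul, mul_zero, AddChar.map_zero_eq_one]
    field_simp

variable {i l : ι → K} {a : ι → F} {A : ι → Prop}

/-- Solid left ends lie at distinct nodes, so their vectors can be rows of one matrix; the remaining
rows are taken from the identity. -/
theorem IsAlternating.exists_rows [Fintype F] (H : IsAlternating i l a A) {z : ι → K → F}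
    (hz : ∀ α, z α ∈ solidVecs F (A α) (i α) (l α)) :
    ∃ g : U K F, ∀ β, ¬ A β → g.1.1 (i β) = z β := by
  let M : K → K → F := fun j =>
    if h : ∃ β, ¬ A β ∧ i β = j then z h.choose else Pi.single j 1
  have hM : ∀ j, M j ∈ rowVecs j (1 : F) := by
    intro j
    by_cases h : ∃ β, ¬ A β ∧ i β = j
    · have h1 := hz h.choose
      rw [solidVecs, if_neg h.choose_spec.1, h.choose_spec.2] at h1
      simpa only [M, dif_pos h] using h1
    · simp only [M, dif_neg h]
      exact mem_rowVecs.2 ⟨by simp, fun k hk => by simp [hk.ne]⟩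
  obtain ⟨g, hg⟩ := exists_mem_U (M := Matrix.of M)
    ⟨fun j => (mem_rowVecs.1 (hM j)).1, fun j k hk => (mem_rowVecs.1 (hM j)).2 k hk⟩
  refine ⟨g, fun β hβ => ?_⟩
  have h : ∃ β', ¬ A β' ∧ i β' = i β := ⟨β, hβ, rfl⟩
  rw [hg]
  change M (i β) = z β
  simp only [M, dif_pos h]
  rw [H.left_inj _ _ h.choose_spec.1 hβ h.choose_spec.2]

theorem IsAlternating.exists_cols [Fintype F] (H : IsAlternating i l a A) {z : ι → K → F}
    (hz : ∀ α, z α ∈ solidVecs F (A α) (i α) (l α)) :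
    ∃ g : U K F, ∀ α, A α → (fun j => g.1.1 j (l α)) = z α := by
  let M : Matrix K K F := Matrix.of fun j k =>
    if h : ∃ α, A α ∧ l α = k then z h.choose j else (Pi.single k 1 : K → F) j
  have hM : ∀ k, (fun j => M j k) ∈ colVecs k (1 : F) := by
    intro k
    by_cases h : ∃ α, A α ∧ l α = k
    · have h1 := hz h.choose
      rw [solidVecs, if_pos h.choose_spec.1, h.choose_spec.2] at h1
      simpa only [M, Matrix.of_apply, dif_pos h] using h1
    · simp only [M, Matrix.of_apply, dif_neg h]
      exact mem_colVecs.2 ⟨by simp, fun j hj => by simp [hj.ne']⟩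
  obtain ⟨g, hg⟩ := exists_mem_U (M := M)
    ⟨fun j => (mem_colVecs.1 (hM j)).1, fun j k hk => (mem_colVecs.1 (hM k)).2 j hk⟩
  refine ⟨g, fun α hα => ?_⟩
  have h : ∃ α', A α' ∧ l α' = l α := ⟨α, hα, rfl⟩
  funext j
  rw [hg]
  simp only [M, Matrix.of_apply, dif_pos h]
  rw [H.right_inj _ _ h.choose_spec.1 hα h.choose_spec.2]

theorem isStrictUpper_mul_mul_iff (g h : U K F) (N : Matrix K K F) :
    IsStrictUpper (g.1.1 * N * h.1.1) ↔ IsStrictUpper N := by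
  refine ⟨fun H => ?_, fun H => (H.mul_left g).mul_right h⟩
  have h1 := (H.mul_left g⁻¹).mul_right h⁻¹
  have h2 : (g⁻¹).1.1 * (g.1.1 * N * h.1.1) * (h⁻¹).1.1 = N := by
    change (g.1⁻¹).1 * (g.1.1 * N * h.1.1) * (h.1⁻¹).1 = N
    rw [Matrix.mul_assoc g.1.1, Units.inv_mul_cancel_left, Units.mul_inv_cancel_right]
  rwa [h2] at h1

theorem endCondition_iff_of_col {P : Prop} (hP : P) (i l : K) (z : K → F) (N : Matrix K K F)
    (g h : U K F) (hh : (fun j => h.1.1 j l) = z) :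
    EndCondition P i l z N ↔ ∀ j, i < j → (g.1.1 * N * h.1.1) j l = 0 := by
  have h1 : ∀ j, (g.1.1 * N * h.1.1) j l = (g.1.1 *ᵥ (N *ᵥ z)) j := fun j => by
    rw [Matrix.mulVec_mulVec, ← hh]
    rfl
  simp only [EndCondition, hP, true_implies, not_true_eq_false, false_implies, and_true, h1]
  exact (mulVec_forall_eq_zero_iff g i (N *ᵥ z)).symm

theorem endCondition_iff_of_row {P : Prop} (hP : ¬ P) (i l : K) (z : K → F) (N : Matrix K K F)
    (g h : U K F) (hg : g.1.1 i = z) :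
    EndCondition P i l z N ↔ ∀ k, k < l → (g.1.1 * N * h.1.1) i k = 0 := by
  have h1 : ∀ k, (g.1.1 * N * h.1.1) i k = ((z ᵥ* N) ᵥ* h.1.1) k := fun k => by
    rw [Matrix.vecMul_vecMul, ← hg, Matrix.mul_assoc]
    rfl
  simp only [EndCondition, hP, true_implies, not_false_eq_true, false_implies, true_and, h1]
  exact (vecMul_forall_eq_zero_iff h l (z ᵥ* N)).symm

/-- The bijection `N ↦ g N h`, with the vectors `z` as rows of `g` and columns of `h`, turns all
conditions at once into vanishing entries. The count is therefore independent of `z`. -/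
theorem IsAlternating.card_endCondition [Fintype F] (H : IsAlternating i l a A) {z : ι → K → F}
    (hz : ∀ α, z α ∈ solidVecs F (A α) (i α) (l α)) :
    #{N ∈ strictUpper K F | ∀ α, EndCondition (A α) (i α) (l α) (z α) N} =
      Fintype.card F ^ #{s : K × K | s.1 < s.2 ∧ ¬ IsForced A i l s.1 s.2} := by
  obtain ⟨g, hg⟩ := H.exists_rows hz
  obtain ⟨h, hh⟩ := H.exists_cols hz
  have h1 := card_zeroOn (K := K) (F := F) fun j k => k ≤ j ∨ IsForced A i l j k
  simp only [not_or, not_le] at h1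
  rw [← h1]
  refine Finset.card_equiv ((Units.mulLeft g.1).trans (Units.mulRight h.1)) fun N => ?_
  have h2 : ((Units.mulLeft g.1).trans (Units.mulRight h.1)) N = g.1.1 * N * h.1.1 := rfl
  rw [h2, Finset.mem_filter, mem_zeroOn, mem_strictUpper,
    ← isStrictUpper_mul_mul_iff g h N]
  constructor
  · rintro ⟨h3, h4⟩ j k (hjk | ⟨α, hα, hj, rfl⟩ | ⟨β, hβ, rfl, hk⟩)
    · exact h3 j k hjk
    · exact (endCondition_iff_of_col hα _ _ _ _ g h (hh α hα)).1 (h4 α) j hj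
    · exact (endCondition_iff_of_row hβ _ _ _ _ g h (hg β hβ)).1 (h4 β) k hk
  · refine fun h3 => ⟨fun j k hjk => h3 j k (Or.inl hjk), fun α => ?_⟩
    by_cases hα : A α
    · exact (endCondition_iff_of_col hα _ _ _ _ g h (hh α hα)).2 fun j hj =>
        h3 j _ (Or.inr (Or.inl ⟨α, hα, hj, rfl⟩))
    · exact (endCondition_iff_of_row hα _ _ _ _ g h (hg α hα)).2 fun k hk =>
        h3 _ k (Or.inr (Or.inr ⟨α, hα, rfl, hk⟩))

variable [Fintype ι]

/-- Each position is forced once for each arc below which it lies, and twice exactly at the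
crossings. -/
theorem IsAlternating.card_not_forced (H : IsAlternating i l a A) :
    #{s : K × K | s.1 < s.2 ∧ ¬ IsForced A i l s.1 s.2} +
        ∑ α, #{j : K | i α < j ∧ j < l α} =
      #{s : K × K | s.1 < s.2} +
        #{p : ι × ι | A p.1 ∧ ¬ A p.2 ∧ i p.1 < i p.2 ∧ i p.2 < l p.1 ∧ l p.1 < l p.2} := by
  -- `P` and `Q` are the positions forced by the two kinds of arcs. Arcs of one kind force disjoint
  -- sets, because their solid ends are distinct; a position in `P ∩ Q` is `(i β, l α)` for a unique
  -- crossing.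
  let P : Finset (K × K) := {s | s.1 < s.2 ∧ ∃ α, A α ∧ i α < s.1 ∧ s.2 = l α}
  let Q : Finset (K × K) := {s | s.1 < s.2 ∧ ∃ β, ¬ A β ∧ s.1 = i β ∧ s.2 < l β}
  have hP : ∑ α with A α, #{j : K | i α < j ∧ j < l α} = #P := by
    rw [← Finset.card_sigma]
    refine Finset.card_bij (fun x _ => (x.2, l x.1)) ?_ ?_ ?_
    · rintro ⟨α, j⟩ hx
      simp only [mem_sigma, mem_filter, mem_univ, true_and] at hx
      simp only [P, mem_filter, mem_univ, true_and]
      exact ⟨hx.2.2, α, hx.1, hx.2.1, rfl⟩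
    · rintro ⟨α, j⟩ hx ⟨α', j'⟩ hx' h
      simp only [mem_sigma, mem_filter, mem_univ, true_and] at hx hx'
      obtain ⟨rfl, h2⟩ := Prod.mk.inj h
      obtain rfl := H.right_inj α α' hx.1 hx'.1 h2
      rfl
    · rintro ⟨j, k⟩ hs
      simp only [P, mem_filter, mem_univ, true_and] at hs
      obtain ⟨hjk, α, hα, hj, rfl⟩ := hs
      exact ⟨⟨α, j⟩, by simp [hα, hj, hjk], rfl⟩
  have hQ : ∑ β with ¬ A β, #{k : K | i β < k ∧ k < l β} = #Q := by
    rw [← Finset.card_sigma]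
    refine Finset.card_bij (fun x _ => (i x.1, x.2)) ?_ ?_ ?_
    · rintro ⟨β, k⟩ hx
      simp only [mem_sigma, mem_filter, mem_univ, true_and] at hx
      simp only [Q, mem_filter, mem_univ, true_and]
      exact ⟨hx.2.1, β, hx.1, rfl, hx.2.2⟩
    · rintro ⟨β, k⟩ hx ⟨β', k'⟩ hx' h
      simp only [mem_sigma, mem_filter, mem_univ, true_and] at hx hx'
      obtain ⟨h2, rfl⟩ := Prod.mk.inj h
      obtain rfl := H.left_inj β β' hx.1 hx'.1 h2
      rfl
    · rintro ⟨j, k⟩ hs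
      simp only [Q, mem_filter, mem_univ, true_and] at hs
      obtain ⟨hjk, β, hβ, rfl, hk⟩ := hs
      exact ⟨⟨β, k⟩, by simp [hβ, hk, hjk], rfl⟩
  have hPQ : #{p : ι × ι | A p.1 ∧ ¬ A p.2 ∧ i p.1 < i p.2 ∧ i p.2 < l p.1 ∧ l p.1 < l p.2} =
      #(P ∩ Q) := by
    refine Finset.card_bij (fun p _ => (i p.2, l p.1)) ?_ ?_ ?_
    · rintro ⟨α, β⟩ hp
      simp only [mem_filter, mem_univ, true_and] at hp
      simp only [P, Q, mem_inter, mem_filter, mem_univ, true_and]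
      obtain ⟨h1, h2, h3, h4, h5⟩ := hp
      exact ⟨⟨h4, α, h1, h3, rfl⟩, h4, β, h2, rfl, h5⟩
    · rintro ⟨α, β⟩ hp ⟨α', β'⟩ hp' h
      simp only [mem_filter, mem_univ, true_and] at hp hp'
      obtain ⟨h1, h2⟩ := Prod.mk.inj h
      rw [H.left_inj β β' hp.2.1 hp'.2.1 h1, H.right_inj α α' hp.1 hp'.1 h2]
    · rintro ⟨j, k⟩ hs
      simp only [P, Q, mem_inter, mem_filter, mem_univ, true_and] at hs
      obtain ⟨⟨hjk, α, hα, hj, rfl⟩, -, β, hβ, rfl, hk⟩ := hs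
      exact ⟨(α, β), by simp [hα, hβ, hj, hjk, hk], rfl⟩
  have hU : #{s : K × K | s.1 < s.2} =
      #(P ∪ Q) + #{s : K × K | s.1 < s.2 ∧ ¬ IsForced A i l s.1 s.2} := by
    rw [← Finset.card_filter_add_card_filter_not (s := ({s : K × K | s.1 < s.2} : Finset _))
      (fun s => IsForced A i l s.1 s.2), Finset.filter_filter, Finset.filter_filter]
    congr 2
    ext s
    simp only [P, Q, IsForced, mem_union, mem_filter, mem_univ, true_and, and_or_left]
  have hI := Finset.card_union_add_card_inter P Q
  rw [← Finset.sum_filter_add_sum_filter_not univ A, hP, hQ, hPQ, hU]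
  omega

/-- The sum of the product of the characters of an alternating family over the group. -/
theorem IsAlternating.sum_prod_pairSum [Fintype F] (H : IsAlternating i l a A) {θ : AddChar F ℂ}
    (hθ : θ ≠ 1) :
    ∑ N ∈ strictUpper K F, ∏ α, (pairNorm F (i α) (l α) * pairSum θ (a α) (i α) (l α) 1 1 N) =
      (Fintype.card (U K F) : ℂ) * (Fintype.card F : ℂ) ^
        #{p : ι × ι | A p.1 ∧ ¬ A p.2 ∧ i p.1 < i p.2 ∧ i p.2 < l p.1 ∧ l p.1 < l p.2} := by
  have h1 : ∀ N : Matrix K K F,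
      ∏ α, (pairNorm F (i α) (l α) * pairSum θ (a α) (i α) (l α) 1 1 N) =
        (Fintype.card F : ℂ) ^ (∑ α, #{j : K | i α < j ∧ j < l α}) *
          (∏ α, (#(solidVecs F (A α) (i α) (l α)) : ℂ))⁻¹ *
          ∑ z ∈ Fintype.piFinset fun α => solidVecs F (A α) (i α) (l α),
            if ∀ α, EndCondition (A α) (i α) (l α) (z α) N then 1 else 0 := fun N => by
    rw [Finset.prod_mul_distrib, H.prod_pairSum_eq, ← Finset.prod_mul_distrib]
    simp_rw [fun α => pairNorm_mul_pairSum hθ (H.label_ne_zero α) (A α) (i α) (l α) N]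
    rw [Finset.prod_mul_distrib, Finset.prod_mul_distrib, Finset.prod_pow_eq_pow_sum,
      Finset.prod_inv_distrib, Finset.prod_univ_sum]
    congr 1
    refine Finset.sum_congr rfl fun z _ => ?_
    rw [Finset.prod_boole]
    simp only [mem_univ, true_implies]
  simp_rw [h1]
  rw [← Finset.mul_sum, Finset.sum_comm]
  -- The number of admissible `N` is the same for every `z`, so the average over `z` disappears.
  have h2 : ∀ z ∈ Fintype.piFinset fun α => solidVecs F (A α) (i α) (l α),
      ∑ N ∈ strictUpper K F,
        (if ∀ α, EndCondition (A α) (i α) (l α) (z α) N then 1 else 0 : ℂ) =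
      (Fintype.card F : ℂ) ^ #{s : K × K | s.1 < s.2 ∧ ¬ IsForced A i l s.1 s.2} := by
    intro z hz
    rw [Finset.sum_boole, ← Nat.cast_pow, ← H.card_endCondition (Fintype.mem_piFinset.1 hz)]
    congr!
  rw [Finset.sum_congr rfl h2, Finset.sum_const, Fintype.card_piFinset, nsmul_eq_mul,
    Nat.cast_prod, card_U, Nat.cast_pow, ← pow_add, ← H.card_not_forced, pow_add]
  have h3 : (∏ α, (#(solidVecs F (A α) (i α) (l α)) : ℂ)) ≠ 0 := by
    refine Finset.prod_ne_zero_iff.2 fun α _ => ?_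
    rw [solidVecs]
    split_ifs <;> exact card_agreeOn_ne_zero _ _
  field_simp

end Count

/-! ### From the stacked labels to alternating families. -/

section Stacks

open Finset
open scoped Classical

variable {F : Type*} [Field F] {lam : Multiset (Arc F)} {K : Finset ℕ+} {pos : lam.ToType ↪ ℕ}

theorem stackIndex_lt {α β : lam.ToType} (hl : α.1.left = β.1.left) (hr : α.1.right = β.1.right)
    (h : pos α < pos β) : stackIndex pos α < stackIndex pos β := by
  refine Set.ncard_lt_ncard ⟨fun γ hγ => ⟨hγ.1.trans hl, hγ.2.1.trans hr, hγ.2.2.trans h⟩,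
    fun hsub => ?_⟩ (Set.toFinite _)
  exact lt_irrefl _ (hsub (show α ∈ _ from ⟨hl, hr, h⟩)).2.2

theorem stackIndex_ne {α β : lam.ToType} (hl : α.1.left = β.1.left) (hr : α.1.right = β.1.right)
    (h : α ≠ β) : stackIndex pos α ≠ stackIndex pos β := by
  rcases lt_or_gt_of_ne (pos.injective.ne h) with h1 | h1
  · exact (stackIndex_lt hl hr h1).ne
  · exact (stackIndex_lt hl.symm hr.symm h1).ne'

theorem leftHeight_ne {α β : lam.ToType} (hl : α.1.left = β.1.left) (hr : α.1.right = β.1.right)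
    (h : α ≠ β) : leftHeight pos α ≠ leftHeight pos β := by
  have h1 := stackIndex_ne (pos := pos) hl hr h
  rw [leftHeight, leftHeight, hl, hr]
  split_ifs
  · exact (Equiv.injective _).ne h1
  · exact h1

theorem startsBelow_or {α β : lam.ToType} (hl : α.1.left = β.1.left) (h : α ≠ β) :
    StartsBelow pos α β ∨ StartsBelow pos β α := by
  rcases lt_trichotomy α.1.right β.1.right with h1 | h1 | h1
  · exact Or.inl ⟨hl, Or.inl h1⟩
  · rcases lt_or_gt_of_ne (leftHeight_ne (pos := pos) hl h1 h) with h2 | h2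
    · exact Or.inl ⟨hl, Or.inr ⟨h1, h2⟩⟩
    · exact Or.inr ⟨hl.symm, Or.inr ⟨h1.symm, h2⟩⟩
  · exact Or.inr ⟨hl.symm, Or.inl h1⟩

theorem endsBelow_or {α β : lam.ToType} (hr : α.1.right = β.1.right) (h : α ≠ β) :
    EndsBelow pos α β ∨ EndsBelow pos β α := by
  rcases lt_trichotomy α.1.left β.1.left with h1 | h1 | h1
  · exact Or.inr ⟨hr.symm, Or.inl h1⟩
  · rcases lt_or_gt_of_ne (stackIndex_ne (pos := pos) h1 hr h) with h2 | h2
    · exact Or.inl ⟨hr, Or.inr ⟨h1, h2⟩⟩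
    · exact Or.inr ⟨hr.symm, Or.inr ⟨h1.symm, h2⟩⟩
  · exact Or.inl ⟨hr, Or.inl h1⟩

/-- At each node at which arcs start, one of them is on the top of the stack. -/
theorem exists_top_left (pos : lam.ToType ↪ ℕ) (α : lam.ToType) :
    ∃ β : lam.ToType, β.1.left = α.1.left ∧ ¬ ∃ γ, StartsBelow pos β γ := by
  obtain ⟨β, hβ, hmax⟩ := Finset.exists_max_image
    (univ.filter fun β : lam.ToType => β.1.left = α.1.left)
    (fun β => toLex (β.1.right, leftHeight pos β)) ⟨α, by simp⟩
  simp only [mem_filter, mem_univ, true_and] at hβ hmax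
  refine ⟨β, hβ, fun ⟨γ, hl, h⟩ => ?_⟩
  exact not_lt_of_ge (hmax γ (hl.symm.trans hβ)) (Prod.Lex.lt_iff.2 h)

/-- At each node at which arcs end, one of them is on the top of the stack. -/
theorem exists_top_right (pos : lam.ToType ↪ ℕ) (α : lam.ToType) :
    ∃ β : lam.ToType, β.1.right = α.1.right ∧ ¬ ∃ γ, EndsBelow pos β γ := by
  obtain ⟨β, hβ, hmax⟩ := Finset.exists_max_image
    (univ.filter fun β : lam.ToType => β.1.right = α.1.right)
    -- The order is reversed because among arcs with a common right end the longer one has the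
    -- smaller left end.
    (fun β => toLex (OrderDual.toDual β.1.left, rightHeight pos β)) ⟨α, by simp⟩
  simp only [mem_filter, mem_univ, true_and] at hβ hmax
  refine ⟨β, hβ, fun ⟨γ, hr, h⟩ => ?_⟩
  refine not_lt_of_ge (hmax γ (hr.symm.trans hβ)) (Prod.Lex.lt_iff.2 ?_)
  exact h.imp id fun h => ⟨congrArg OrderDual.toDual h.1, h.2⟩

theorem wt_eq_sum (lam : Multiset (Arc F)) (j k : ℕ+) :
    wt lam j k = ∑ γ : lam.ToType with γ.1.left = j ∧ γ.1.right = k, γ.1.label := by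
  have h : wt lam j k = wt ((univ : Finset lam.ToType).val.map fun γ => γ.1) j k :=
    congrArg (fun m => wt m j k) (Multiset.map_univ_coe lam).symm
  rw [h, wt, arcsBetween, Multiset.filter_map, Multiset.map_map]
  rfl

theorem Lam_eq_hollow_solid (hlam : IsArcMultiset K lam) {α : lam.ToType} :
    Lam K pos α = (Mark.hollow, Mark.solid) ↔
      (∃ β, StartsBelow pos α β) ∧ ¬ ∃ β, EndsBelow pos α β := by
  have h := hlam α.1 (Multiset.coe_mem (x := α))
  simp only [Lam, h.1, h.2, not_true_eq_false, false_or, Prod.mk.injEq]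
  refine and_congr ?_ ?_ <;> split_ifs <;> simp_all

theorem Lam_eq_solid_hollow (hlam : IsArcMultiset K lam) {α : lam.ToType} :
    Lam K pos α = (Mark.solid, Mark.hollow) ↔
      (¬ ∃ β, StartsBelow pos α β) ∧ ∃ β, EndsBelow pos α β := by
  have h := hlam α.1 (Multiset.coe_mem (x := α))
  simp only [Lam, h.1, h.2, not_true_eq_false, false_or, Prod.mk.injEq]
  refine and_congr ?_ ?_ <;> split_ifs <;> simp_all

/-- Each stack is totally ordered, so it has exactly one solid end, lying above all its hollow ends.
Since each arc has one end of either kind, the solid end on top of a left stack belongs to a `(•,∘)`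
arc, and on top of a right stack to a `(∘,•)` arc. -/
theorem isAlternating_of_Lam (hlam : IsArcMultiset K lam)
    (hlabel : ∀ α : lam.ToType,
      Lam K pos α = (Mark.hollow, Mark.solid) ∨ Lam K pos α = (Mark.solid, Mark.hollow)) :
    IsAlternating (ι := lam.ToType)
      (fun α => (⟨α.1.left, (hlam α.1 (Multiset.coe_mem (x := α))).1⟩ : K))
      (fun α => (⟨α.1.right, (hlam α.1 (Multiset.coe_mem (x := α))).2⟩ : K))
      (fun α => α.1.label) fun α => Lam K pos α = (Mark.hollow, Mark.solid) := by
  have hB : ∀ α : lam.ToType, ¬ Lam K pos α = (Mark.hollow, Mark.solid) →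
      (¬ ∃ β, StartsBelow pos α β) ∧ ∃ β, EndsBelow pos α β := fun α hα =>
    (Lam_eq_solid_hollow hlam).1 ((hlabel α).resolve_left hα)
  have hA : ∀ α : lam.ToType, Lam K pos α = (Mark.hollow, Mark.solid) →
      (∃ β, StartsBelow pos α β) ∧ ¬ ∃ β, EndsBelow pos α β := fun α =>
    (Lam_eq_hollow_solid hlam).1
  have hR : ∀ α α' : lam.ToType, Lam K pos α = (Mark.hollow, Mark.solid) →
      Lam K pos α' = (Mark.hollow, Mark.solid) → α.1.right = α'.1.right → α = α' := by
    intro α α' hα hα' h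
    by_contra hne
    exact (endsBelow_or h hne).elim (fun h1 => (hA α hα).2 ⟨_, h1⟩)
      fun h1 => (hA α' hα').2 ⟨_, h1⟩
  have hL : ∀ α α' : lam.ToType, ¬ Lam K pos α = (Mark.hollow, Mark.solid) →
      ¬ Lam K pos α' = (Mark.hollow, Mark.solid) → α.1.left = α'.1.left → α = α' := by
    intro α α' hα hα' h
    by_contra hne
    exact (startsBelow_or h hne).elim (fun h1 => (hB α hα).1 ⟨_, h1⟩)
      fun h1 => (hB α' hα').1 ⟨_, h1⟩
  have hS : ∀ α β : lam.ToType, Lam K pos α = (Mark.hollow, Mark.solid) →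
      ¬ Lam K pos β = (Mark.hollow, Mark.solid) → α.1.left = β.1.left → StartsBelow pos α β := by
    intro α β hα hβ h
    have hne : α ≠ β := fun h => hβ (h ▸ hα)
    exact (startsBelow_or h hne).resolve_right fun h1 => (hB β hβ).1 ⟨_, h1⟩
  have hE : ∀ α β : lam.ToType, Lam K pos α = (Mark.hollow, Mark.solid) →
      ¬ Lam K pos β = (Mark.hollow, Mark.solid) → α.1.right = β.1.right → EndsBelow pos β α := by
    intro α β hα hβ h
    have hne : α ≠ β := fun h => hβ (h ▸ hα)
    exact (endsBelow_or h hne).resolve_left fun h1 => (hA α hα).2 ⟨_, h1⟩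
  refine ⟨fun α => α.1.label_ne_zero,
    fun α α' hα hα' h => hR α α' hα hα' (congrArg Subtype.val h),
    fun β β' hβ hβ' h => hL β β' hβ hβ' (congrArg Subtype.val h), ?_, ?_, ?_, ?_, ?_⟩
  · intro α _
    obtain ⟨β, hβ, htop⟩ := exists_top_left pos α
    exact ⟨β, fun h => htop (hA β h).1, Subtype.ext hβ⟩
  · intro β _
    obtain ⟨α, hα, htop⟩ := exists_top_right pos β
    refine ⟨α, ?_, Subtype.ext hα⟩
    by_contra h
    exact htop (hB α h).2
  · intro α β hα hβ h
    rcases (hS α β hα hβ (congrArg Subtype.val h)).2 with h1 | h1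
    · exact h1.le
    · exact h1.1.le
  · intro α β hα hβ h
    rcases (hE α β hα hβ (congrArg Subtype.val h)).2 with h1 | h1
    · exact h1.le
    · exact h1.1.ge
  · intro α β hα hβ hi hl
    have hi' : α.1.left = β.1.left := congrArg Subtype.val hi
    have hl' : α.1.right = β.1.right := congrArg Subtype.val hl
    have hne : α ≠ β := fun h => hβ (h ▸ hα)
    have h1 : leftHeight pos α < leftHeight pos β := by
      rcases (hS α β hα hβ hi').2 with h | h
      · exact (h.ne hl').elim
      · exact h.2
    have h2 : stackIndex pos β < stackIndex pos α := by
      rcases (hE α β hα hβ hl').2 with h | h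
      · exact (h.ne hi').elim
      · exact h.2
    -- The parallel arcs are stacked in opposite orders at their two ends, which only the
    -- interchange at weight zero can produce.
    have hwt : wt lam α.1.left α.1.right = 0 := by
      by_contra h
      rw [leftHeight, leftHeight, ← hi', ← hl', if_neg h, if_neg h] at h1
      exact lt_asymm h1 h2
    -- There is at most one parallel arc of each kind, so the weight is just the sum of these two
    -- labels.
    have hset : (univ.filter fun γ : lam.ToType =>
        γ.1.left = α.1.left ∧ γ.1.right = α.1.right) = {α, β} := by
      ext γ
      simp only [mem_filter, mem_univ, true_and, mem_insert, mem_singleton]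
      constructor
      · rintro ⟨h3, h4⟩
        by_cases hγ : Lam K pos γ = (Mark.hollow, Mark.solid)
        · exact Or.inl (hR γ α hγ hα h4)
        · exact Or.inr (hL γ β hγ hβ (h3.trans hi'))
      · rintro (rfl | rfl)
        · exact ⟨rfl, rfl⟩
        · exact ⟨hi'.symm, hl'.symm⟩
    rw [wt_eq_sum, hset, Finset.sum_pair hne] at hwt
    exact hwt

end Stacks

end UnipotentSupercharacter

open UnipotentSupercharacter
theorem mainTheorem6 {F : Type*} [Field F] [Fintype F] (θ : AddChar F ℂ) (hθ : θ ≠ 1)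
    (K : Finset ℕ+) (lam : Multiset (Arc F)) (hlam : IsArcMultiset K lam)
    (pos : lam.ToType ↪ ℕ)
    (hlabel : ∀ α : lam.ToType,
      Lam K pos α = (Mark.hollow, Mark.solid) ∨ Lam K pos α = (Mark.solid, Mark.hollow)) :
    charInner (chi θ K lam) (1 : U K F → ℂ) =
      (Fintype.card F : ℂ) ^ (crossings K pos).ncard := by
  classical
  have H := isAlternating_of_Lam hlam hlabel
  have hchi : ∀ u : U K F, chi θ K lam u = ∏ α : lam.ToType,
      (pairNorm F (⟨α.1.left, (hlam α.1 (Multiset.coe_mem (x := α))).1⟩ : K)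
          ⟨α.1.right, (hlam α.1 (Multiset.coe_mem (x := α))).2⟩ *
        pairSum θ α.1.label ⟨α.1.left, (hlam α.1 (Multiset.coe_mem (x := α))).1⟩
          ⟨α.1.right, (hlam α.1 (Multiset.coe_mem (x := α))).2⟩ 1 1 (u.1.1 - 1)) := fun u => by
    rw [chi, ← Multiset.map_univ lam]
    exact Finset.prod_congr rfl fun α _ => arcChar_eq hθ α.1 _ _ rfl rfl u
  have hsum := (sum_U _).trans (H.sum_prod_pairSum hθ)
  -- By `hlabel`, not being `(∘,•)` is the same as being `(•,∘)`, so the pairs counted for the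
  -- alternating family are the crossings.
  have hcross : crossings K pos = (({p : lam.ToType × lam.ToType |
      Lam K pos p.1 = (Mark.hollow, Mark.solid) ∧ ¬ Lam K pos p.2 = (Mark.hollow, Mark.solid) ∧
        (⟨p.1.1.left, (hlam p.1.1 (Multiset.coe_mem (x := p.1))).1⟩ : K) <
          ⟨p.2.1.left, (hlam p.2.1 (Multiset.coe_mem (x := p.2))).1⟩ ∧
        (⟨p.2.1.left, (hlam p.2.1 (Multiset.coe_mem (x := p.2))).1⟩ : K) <
          ⟨p.1.1.right, (hlam p.1.1 (Multiset.coe_mem (x := p.1))).2⟩ ∧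
        (⟨p.1.1.right, (hlam p.1.1 (Multiset.coe_mem (x := p.1))).2⟩ : K) <
          ⟨p.2.1.right, (hlam p.2.1 (Multiset.coe_mem (x := p.2))).2⟩} :
        Finset (lam.ToType × lam.ToType)) : Set (lam.ToType × lam.ToType)) := by
    ext p
    rw [Finset.mem_coe, Finset.mem_filter]
    constructor
    · rintro ⟨h1, h2, h3, h4, h5⟩
      exact ⟨Finset.mem_univ _, h4, by rw [h5]; simp, h1, h2, h3⟩
    · rintro ⟨-, h4, h5, h1, h2, h3⟩
      exact ⟨h1, h2, h3, h4, (hlabel p.2).resolve_left h5⟩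
  have hcard : (Fintype.card (U K F) : ℂ) ≠ 0 := Nat.cast_ne_zero.2 Fintype.card_ne_zero
  rw [charInner, hcross, Set.ncard_coe_finset]
  simp only [Pi.one_apply, star_one, mul_one, hchi]
  rw [hsum, inv_mul_cancel_left₀ hcard]
  congr!
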